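/- Let $M,N,Q$ be integers with $1\le M\le N$ and $Q\ge 2$, put $m=2M$, $n=2N$, and consider the uncoded V-BLAST system $$\mathbf r^c=\sqrt{\rho/M}\,\mathbf H^c\mathbf c^c+\mathbf z^c ,$$ where the entries of $\mathbf H^c\in\mathbb C^{N\times M}$ and of $\mathbf z^c\in\mathbb C^{N}$ are i.i.d. circularly symmetric complex Gaussian of mean $0$ and variance $1$, and where the components of $\mathbf c^c$ are drawn independently and uniformly from the unit-energy $Q^2$-QAM constellation. Separating real and imaginary parts and scaling by $\sqrt2$ gives the real model $\mathbf r=\mathbf H(\kappa\mathbf x+\mathbf v)+\mathbf z\in\mathbb R^n$ with $\mathbf x$ uniform on $\{0,\dots,Q-1\}^m$, $\kappa=\sqrt{6/(Q^2-1)}$, $\mathbf v=-\kappa\frac{Q-1}{2}(1,\dots,1)^T$, $\mathbf z\sim\mathcal N(\mathbf 0,\mathbf I_n)$. The receiver knows $\mathbf H$ and $\mathbf v$; it uses a QR decomposition $\kappa\mathbf H=\mathbf U\mathbf R$ ($\mathbf U\in\mathbb R^{n\times m}$ with orthonormal columns, $\mathbf R\in\mathbb R^{m\times m}$ upper triangular),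 forms $\mathbf y=\mathbf U^T(\mathbf r-\mathbf H\mathbf v)$, and searches the tree whose nodes at level $k$ are the vectors $\mathbf x_1^k=(x_1,\dots,x_k)\in\{0,\dots,Q-1\}^k$. Here the components of $\mathbf x$, $\mathbf y$ and the rows and columns of $\mathbf R$ are numbered in reverse order, $w_k(\mathbf x_1^k)=|y_k-\sum_{j\le k}r_{k,j}x_j|^2$, and the node $\mathbf x_1^k$ has the biased path metric $h(\mathbf x_1^k)=\sum_{i\le k}w_i(\mathbf x_1^i)-bk$, where $b\ge 0$ is the bias. The stack algorithm with bias $b$ keeps a list of nodes, at first the root only; at every step it takes the listed node whose best child not yet generated has the least $h$ and adds that child to the list; as soon as a leaf (a node at level $m$) is in the list, it stops and announces that leaf. The Fano decoder with bias $b$ and step size $\Delta>0$ starts at the root with threshold $T=0$ and looks at the best child of the current node. If the $h$ of the child it looks at is at most $T$, it moves to that child (and stops and announces it if it is a leaf); if moreover $h$ of the node just left exceeds $T-\Delta$, it lowers $T$ by multiples of $\Delta$ as far as $h\le T$ still holds at the new node; then it looks at the best child of the new node. If the child has $h>T$ or no child is left, then: at the root, or if the parent of the current node has $h>T$, it replaces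 $T$ by $T+\Delta$ and looks again at the best child of the current node; otherwise it moves back to the parent and looks at the next best child of the parent. (Ties, which have probability zero, are broken by a fixed rule.) Let $P_{\mathrm{ML}}(\rho)$, $P_{\mathrm{stack}}(\rho)$, $P_{\mathrm{Fano}}(\rho)$ be the frame error rates (the probabilities, over $\mathbf x$, $\mathbf H^c$ and $\mathbf z^c$, that the transmitted $\mathbf x$ is not the one announced) of the maximum likelihood decoder over $\{0,\dots,Q-1\}^m$, of the stack algorithm and of the Fano decoder. Then for every fixed $b\ge 0$ and $\Delta>0$ the stack algorithm and the Fano decoder achieve the same diversity order as the maximum likelihood decoder, namely $n/2$: $$\lim_{\rho\to\infty}\frac{-\log P(\rho)}{\log\rho}=\frac n2\qquad\text{for }P=P_{\mathrm{ML}},\,P_{\mathrm{stack}},\,P_{\mathrm{Fano}} ,$$ and each of the three frame error rates decays exactly like $\rho^{-n/2}$: there are constants $0<c\le C$ and $\rho_0$, not depending on $\rho$, with $c\,\rho^{-n/2}\le P(\rho)\le C\,\rho^{-n/2}$ for all $\rho\ge\rho_0$. -/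

import Mathlib

open MeasureTheory ProbabilityTheory Filter Topology Asymptotics

noncomputable section

namespace VBlast

/-! ## System model -/

/-- The circularly symmetric complex Gaussian law of mean `0` and variance `1`: independent real
and imaginary parts, each of mean `0` and variance `1 / 2`. -/
def complexGaussian : Measure ℂ :=
  ((gaussianReal 0 (1 / 2)).prod (gaussianReal 0 (1 / 2))).map
    (fun p : ℝ × ℝ => Complex.equivRealProdCLM.symm p)

instance : IsProbabilityMeasure complexGaussian :=
  Measure.isProbabilityMeasure_map
    (Complex.equivRealProdCLM.symm.continuous.measurable.aemeasurable)

/-- Joint law of the complex channel gains and of the complex noise: all entries are independent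
with the law `complexGaussian`. -/
def channelLaw (N M : ℕ) : Measure ((Fin N → Fin M → ℂ) × (Fin N → ℂ)) :=
  (Measure.pi fun _ => Measure.pi fun _ => complexGaussian).prod
    (Measure.pi fun _ => complexGaussian)

/-- The real `2N × 2M` channel matrix at SNR `ρ`: the real form
`[Re, -Im; Im, Re]` of `√(ρ / M) Hᶜ`, multiplied by `√2` so that the real noise has unit
variance. -/
def realChannel {N M : ℕ} (ρ : ℝ) (h : Fin N → Fin M → ℂ) :
    Matrix (Fin N ⊕ Fin N) (Fin (M + M)) ℝ :=
  Real.sqrt (2 * (ρ / M)) •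
    (Matrix.fromBlocks
      (Matrix.of fun i j => (h i j).re) (-(Matrix.of fun i j => (h i j).im))
      (Matrix.of fun i j => (h i j).im) (Matrix.of fun i j => (h i j).re)).submatrix
      id finSumFinEquiv.symm

/-- The real noise vector `√2 [Re zᶜ; Im zᶜ]`, whose law is standard normal. -/
def realNoise {N : ℕ} (z : Fin N → ℂ) : Fin N ⊕ Fin N → ℝ :=
  Real.sqrt 2 • Sum.elim (fun i => (z i).re) (fun i => (z i).im)

/-- Spacing of the `Q`-PAM constellation for which the `Q²`-QAM constellation
`{κ (a - (Q-1)/2) + κ (a' - (Q-1)/2) i : 0 ≤ a, a' < Q}` has average energy `1`. -/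
def kappa (Q : ℕ) : ℝ := Real.sqrt (6 / ((Q : ℝ) ^ 2 - 1))

/-- The generator matrix `κ I` of uncoded transmission. -/
def generator (Q m : ℕ) : Matrix (Fin m) (Fin m) ℝ := kappa Q • 1

/-- The translation vector that centres the constellation at the origin. -/
def offset (Q m : ℕ) : Fin m → ℝ := fun _ => -(kappa Q * (((Q : ℝ) - 1) / 2))

/-- An information vector in `{0, …, Q-1}^m` as a real vector. -/
def toReal {Q m : ℕ} (x : Fin m → Fin Q) : Fin m → ℝ := fun j => ((x j : ℕ) : ℝ)

/-- The received vector `H (G x + v) + z`. -/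
def received {ι : Type} {Q m : ℕ} (H : Matrix ι (Fin m) ℝ) (z : ι → ℝ) (x : Fin m → Fin Q) :
    ι → ℝ :=
  H.mulVec ((generator Q m).mulVec (toReal x) + offset Q m) + z

/-- The frame error rate at SNR `ρ` of a decoder, for an information vector that is uniform on
`{0, …, Q-1}^{2M}` and independent of channel and noise. The decoder is given by the relation
`decides H r x`: from channel matrix `H` and received vector `r` it stops and announces `x`.
A frame is in error when the decoder does not announce the transmitted vector. -/
def frameErrorRate {N M Q : ℕ}
    (decides : Matrix (Fin N ⊕ Fin N) (Fin (M + M)) ℝ → (Fin N ⊕ Fin N → ℝ) →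
      (Fin (M + M) → Fin Q) → Prop) (ρ : ℝ) : ℝ :=
  (∑ x : Fin (M + M) → Fin Q,
    (channelLaw N M).real {ω | ¬ decides (realChannel ρ ω.1)
      (received (realChannel ρ ω.1) (realNoise ω.2) x) x}) / (Q : ℝ) ^ (M + M)

/-- `P` has diversity order `d`: `- log P(ρ) / log ρ → d` as `ρ → ∞`. -/
def HasDiversityOrder (P : ℝ → ℝ) (d : ℝ) : Prop :=
  Tendsto (fun ρ => -Real.log (P ρ) / Real.log ρ) atTop (𝓝 d)

/-! ## Maximum likelihood decoding -/

/-- Squared Euclidean distance between `r` and the noiseless received vector of `x`. -/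
def mlMetric {ι : Type} [Fintype ι] {Q m : ℕ} (H : Matrix ι (Fin m) ℝ) (r : ι → ℝ)
    (x : Fin m → Fin Q) : ℝ :=
  ∑ i, (r i - H.mulVec (offset Q m) i - (H * generator Q m).mulVec (toReal x) i) ^ 2

/-- `ml` is a maximum likelihood decoder (ties are broken arbitrarily). -/
def IsMLDecoder {ι : Type} [Fintype ι] {Q m : ℕ}
    (ml : Matrix ι (Fin m) ℝ → (ι → ℝ) → (Fin m → Fin Q)) : Prop :=
  ∀ (H : Matrix ι (Fin m) ℝ) (r : ι → ℝ) (x : Fin m → Fin Q),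
    mlMetric H r (ml H r) ≤ mlMetric H r x

/-! ## Preprocessing -/

/-- `A = U R` with orthonormal columns in `U` and upper triangular `R`. -/
structure IsQR {ι : Type} [Fintype ι] {m : ℕ} (A U : Matrix ι (Fin m) ℝ)
    (R : Matrix (Fin m) (Fin m) ℝ) : Prop where
  eq_mul : A = U * R
  orthonormal : U.transpose * U = 1
  upper : ∀ i j, j < i → R i j = 0

/-- The preprocessed received vector `Uᵀ (r - H v)`. -/
def treeInput {ι : Type} [Fintype ι] (Q : ℕ) {m : ℕ} (U H : Matrix ι (Fin m) ℝ) (r : ι → ℝ) :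
    Fin m → ℝ :=
  U.transpose.mulVec (r - H.mulVec (offset Q m))

/-! ## The tree

A node at level `k` is the list of its `k` symbols. Rows and columns are numbered in reverse
order: the symbol at (zero-based) position `l` of a list belongs to coordinate `l.rev`, so that
the first symbol on a path is the last coordinate of the information vector. -/

/-- The squared distance contributed by level `l` (zero-based) along the node `v`. -/
def branchMetric {Q m : ℕ} (R : Matrix (Fin m) (Fin m) ℝ) (y : Fin m → ℝ) (v : List (Fin Q))
    (l : Fin m) : ℝ :=
  (y l.rev - ∑ j ∈ Finset.Iic l, R l.rev j.rev * (v.map fun a => ((a : ℕ) : ℝ)).getD j 0) ^ 2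

/-- The biased path metric `∑_{i ≤ k} w_i - b k` of a node at level `k`. -/
def pathMetric {Q m : ℕ} (R : Matrix (Fin m) (Fin m) ℝ) (y : Fin m → ℝ) (b : ℝ)
    (v : List (Fin Q)) : ℝ :=
  (∑ l ∈ Finset.univ.filter (fun l : Fin m => (l : ℕ) < v.length), branchMetric R y v l) - b * v.length

open Classical in
/-- The last symbols of the children of `v`, from the best child to the worst (a stable sort:
among equally good children the smaller symbol comes first). -/
def children {Q m : ℕ} (R : Matrix (Fin m) (Fin m) ℝ) (y : Fin m → ℝ) (b : ℝ)
    (v : List (Fin Q)) : List (Fin Q) :=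
  (List.finRange Q).insertionSort
    fun a a' => pathMetric R y b (v ++ [a]) ≤ pathMetric R y b (v ++ [a'])

/-- The leaf that corresponds to an information vector. -/
def leaf {Q m : ℕ} (x : Fin m → Fin Q) : List (Fin Q) := List.ofFn fun l => x l.rev

/-! ## The stack algorithm -/

/-- State of the stack algorithm: the list ACTIVE, where every node carries the number of its
children that have been generated so far, or the announced leaf. -/
inductive StackState (Q : ℕ) : Type
  | active (l : List (List (Fin Q) × ℕ)) : StackState Q
  | halted (v : List (Fin Q)) : StackState Q

/-- Cost function of an entry of ACTIVE: `-∞` for a leaf, otherwise the path metric of the best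
child that has not been generated yet (`+∞` if there is none). -/
def stackCost {Q m : ℕ} (R : Matrix (Fin m) (Fin m) ℝ) (y : Fin m → ℝ) (b : ℝ)
    (p : List (Fin Q) × ℕ) : EReal :=
  if p.1.length = m then ⊥
  else match (children R y b p.1)[p.2]? with
    | none => ⊤
    | some a => (pathMetric R y b (p.1 ++ [a]) : EReal)

open Classical in
/-- One round of the stack algorithm: sort ACTIVE by ascending cost; stop if a leaf is on top;
otherwise generate the best child of the top node not generated before, or remove the top node
if it has no such child. -/
def stackStep {Q m : ℕ} (R : Matrix (Fin m) (Fin m) ℝ) (y : Fin m → ℝ) (b : ℝ) :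
    StackState Q → StackState Q
  | .halted v => .halted v
  | .active l =>
    match l.insertionSort fun p q => stackCost R y b p ≤ stackCost R y b q with
    | [] => .active []
    | (v, i) :: rest =>
      if v.length = m then .halted v
      else match (children R y b v)[i]? with
        | none => .active rest
        | some a => .active ((v ++ [a], 0) :: (v, i + 1) :: rest)

/-- The stack algorithm with bias `b`, started with the root alone in ACTIVE, stops and announces
`x`. -/
def StackOutputs {Q m : ℕ} (R : Matrix (Fin m) (Fin m) ℝ) (y : Fin m → ℝ) (b : ℝ)
    (x : Fin m → Fin Q) : Prop :=
  ∃ t : ℕ, (stackStep R y b)^[t] (.active [([], 0)]) = .halted (leaf x)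

/-! ## The Fano decoder -/

/-- State of the Fano decoder: the current node `v`, the threshold `T` and the rank `i` (from the
best, number `0`) of the child of `v` that is looked at; or the announced leaf. -/
inductive FanoState (Q : ℕ) : Type
  | look (v : List (Fin Q)) (T : ℝ) (i : ℕ) : FanoState Q
  | halted (v : List (Fin Q)) : FanoState Q

/-- The threshold after the loop `while f ≤ T - Δ, T ← T - Δ` (for `f ≤ T`). -/
def tighten (Δ f T : ℝ) : ℝ := T - (⌊(T - f) / Δ⌋₊ : ℝ) * Δ

open Classical in
/-- The Fano decoder cannot move forward: if it cannot move back either, it relaxes the threshold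
and looks at the best child again; otherwise it moves back to the parent and looks at the next
best child of the parent. -/
def fanoBack {Q m : ℕ} (R : Matrix (Fin m) (Fin m) ℝ) (y : Fin m → ℝ) (b Δ : ℝ)
    (v : List (Fin Q)) (T : ℝ) : FanoState Q :=
  match v.getLast? with
  | none => .look v (T + Δ) 0
  | some a =>
    if pathMetric R y b v.dropLast > T then .look v (T + Δ) 0
    else .look v.dropLast T ((children R y b v.dropLast).idxOf a + 1)

open Classical in
/-- One round of the Fano decoder with bias `b` and step size `Δ`. -/
def fanoStep {Q m : ℕ} (R : Matrix (Fin m) (Fin m) ℝ) (y : Fin m → ℝ) (b Δ : ℝ) :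
    FanoState Q → FanoState Q
  | .halted v => .halted v
  | .look v T i =>
    match (children R y b v)[i]? with
    | none => fanoBack R y b Δ v T
    | some a =>
      if pathMetric R y b (v ++ [a]) ≤ T then
        if v.length + 1 = m then .halted (v ++ [a])
        else if pathMetric R y b v > T - Δ then
          .look (v ++ [a]) (tighten Δ (pathMetric R y b (v ++ [a])) T) 0
        else .look (v ++ [a]) T 0
      else fanoBack R y b Δ v T

/-- The Fano decoder with bias `b` and step size `Δ`, started at the root with threshold `0`,
stops and announces `x`. -/
def FanoOutputs {Q m : ℕ} (R : Matrix (Fin m) (Fin m) ℝ) (y : Fin m → ℝ) (b Δ : ℝ)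
    (x : Fin m → Fin Q) : Prop :=
  ∃ t : ℕ, (fanoStep R y b Δ)^[t] (.look [] 0 0) = .halted (leaf x)

/-! ## The three decoders -/

/-- Maximum likelihood decoding. -/
def mlDecides {ι : Type} {Q m : ℕ} (ml : Matrix ι (Fin m) ℝ → (ι → ℝ) → (Fin m → Fin Q))
    (H : Matrix ι (Fin m) ℝ) (r : ι → ℝ) (x : Fin m → Fin Q) : Prop :=
  ml H r = x

/-- Decoding by the stack algorithm, after the preprocessing `H G = U R` given by `qr`. -/
def stackDecides {ι : Type} [Fintype ι] {Q m : ℕ}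
    (qr : Matrix ι (Fin m) ℝ → Matrix ι (Fin m) ℝ × Matrix (Fin m) (Fin m) ℝ) (b : ℝ)
    (H : Matrix ι (Fin m) ℝ) (r : ι → ℝ) (x : Fin m → Fin Q) : Prop :=
  StackOutputs (qr (H * generator Q m)).2 (treeInput Q (qr (H * generator Q m)).1 H r) b x

/-- Decoding by the Fano decoder, after the preprocessing `H G = U R` given by `qr`. -/
def fanoDecides {ι : Type} [Fintype ι] {Q m : ℕ}
    (qr : Matrix ι (Fin m) ℝ → Matrix ι (Fin m) ℝ × Matrix (Fin m) (Fin m) ℝ) (b Δ : ℝ)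
    (H : Matrix ι (Fin m) ℝ) (r : ι → ℝ) (x : Fin m → Fin Q) : Prop :=
  FanoOutputs (qr (H * generator Q m)).2 (treeInput Q (qr (H * generator Q m)).1 H r) b Δ x

end VBlast

end

/-!
Both sequential decoders find a leaf whose biased path metric is almost as good as the worst prefix
of the transmitted path. The stack algorithm only ever extends a node whose best remaining
child is at most as costly as some prefix of any given path (`stack_halts`). The threshold of
the Fano decoder is raised at the root only after every path has been found to exceed it, and
tightening inside a subtree is undone before the subtree is left (`fano_explores`, `fano_halts`).
As the bias changes path metrics by a bounded amount, an error of either decoder, like one of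
maximum likelihood, forces some wrong vector `x'` to satisfy `‖A d‖² + 2 ⟨z, A d⟩ ≤ B`, where
`d = x - x'`, `A = H G`, and `B` depends neither on the channel nor on the SNR (`ErrsClosely`).

Upper bound: Chernoff's bound with parameter `1 / 2`, averaged over the noise, bounds the
probability of this event by a constant times the mean of `exp (- ∑ᵢ |wᵢ|² / 4)`, where `w` is
the complex form of the signal difference. The `wᵢ` are independent, and since the complex
Gaussian law is at most Lebesgue measure each of the `N` factors is `O(1 / ρ)`
(`channelLaw_isClose_le`). Finitely many pairs `x`, `x'` give `O(ρ ^ (-N))`.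

Lower bound: this holds for every decoder that announces at most one vector. Take two vectors that
differ by one in a single coordinate. With probability of order `ρ ^ (-N)` the corresponding
column of the channel is so weak that the signal difference is at most `1` on every receive
antenna; on this event shifting the noise by the difference changes probabilities by at most a
constant factor (`exists_channelLaw_shift_le`), so the decoder cannot be right for both vectors.
All bounds are monotone in the error events and therefore apply to outer measures: no
measurability of the decoders is needed.
-/

noncomputable section

namespace VBlast

/-! ### The children of a node -/

section TreeSearch

variable {Q m : ℕ} {R : Matrix (Fin m) (Fin m) ℝ} {y : Fin m → ℝ} {b : ℝ}

open Classical in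
lemma children_perm (v : List (Fin Q)) : (children R y b v).Perm (List.finRange Q) :=
  List.perm_insertionSort _ _

lemma mem_children (v : List (Fin Q)) (a : Fin Q) : a ∈ children R y b v :=
  (children_perm v).mem_iff.2 (List.mem_finRange a)

lemma length_children (v : List (Fin Q)) : (children R y b v).length = Q := by
  rw [(children_perm v).length_eq, List.length_finRange]

lemma nodup_children (v : List (Fin Q)) : (children R y b v).Nodup :=
  (children_perm v).nodup_iff.2 (List.nodup_finRange Q)

lemma exists_getElem?_children (v : List (Fin Q)) (a : Fin Q) :
    ∃ j : ℕ, (children R y b v)[j]? = some a :=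
  List.mem_iff_getElem?.1 (mem_children v a)

open Classical in
lemma pathMetric_children_mono {v : List (Fin Q)} {i j : ℕ} {a a' : Fin Q} (hij : i ≤ j)
    (hi : (children R y b v)[i]? = some a) (hj : (children R y b v)[j]? = some a') :
    pathMetric R y b (v ++ [a]) ≤ pathMetric R y b (v ++ [a']) := by
  rcases hij.eq_or_lt with rfl | hlt
  · rw [hi] at hj
    rw [Option.some.inj hj]
  let r : Fin Q → Fin Q → Prop :=
    fun a a' => pathMetric R y b (v ++ [a]) ≤ pathMetric R y b (v ++ [a'])
  have : Std.Total r := ⟨fun _ _ => le_total _ _⟩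
  have : IsTrans (Fin Q) r := ⟨fun _ _ _ => le_trans⟩
  have hs : (children R y b v).Pairwise r := List.pairwise_insertionSort r _
  obtain ⟨hi', rfl⟩ := List.getElem?_eq_some_iff.1 hi
  obtain ⟨hj', rfl⟩ := List.getElem?_eq_some_iff.1 hj
  exact List.pairwise_iff_getElem.1 hs i j hi' hj' hlt

lemma exists_child_prefix {v w : List (Fin Q)} (hvw : v <+: w) (hlt : v.length < w.length) :
    ∃ a, v ++ [a] <+: w := by
  obtain ⟨t, rfl⟩ := hvw
  cases t with
  | nil => simp at hlt
  | cons a t => exact ⟨a, t, by simp⟩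

lemma pathMetric_nil : pathMetric R y b ([] : List (Fin Q)) = 0 := by
  simp [pathMetric]

/-! ### The Fano decoder -/

/-- The Fano decoder passes from the state `s` to the state `s'` in finitely many rounds. -/
def FanoReaches (R : Matrix (Fin m) (Fin m) ℝ) (y : Fin m → ℝ) (b Δ : ℝ)
    (s s' : FanoState Q) : Prop :=
  ∃ t : ℕ, (fanoStep R y b Δ)^[t] s = s'

variable {Δ : ℝ}

lemma FanoReaches.trans {s s' s'' : FanoState Q} (h : FanoReaches R y b Δ s s')
    (h' : FanoReaches R y b Δ s' s'') : FanoReaches R y b Δ s s'' := by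
  obtain ⟨t, rfl⟩ := h
  obtain ⟨t', rfl⟩ := h'
  exact ⟨t' + t, Function.iterate_add_apply _ _ _ _⟩

lemma FanoReaches.step (s : FanoState Q) : FanoReaches R y b Δ s (fanoStep R y b Δ s) := ⟨1, rfl⟩

/-- The Fano decoder, started in the state `s`, announces a leaf whose path metric is at
most `T`. -/
def FanoHaltsBelow (R : Matrix (Fin m) (Fin m) ℝ) (y : Fin m → ℝ) (b Δ T : ℝ)
    (s : FanoState Q) : Prop :=
  ∃ w : List (Fin Q), w.length = m ∧ pathMetric R y b w ≤ T ∧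
    FanoReaches R y b Δ s (.halted w)

lemma FanoHaltsBelow.of_reaches {s s' : FanoState Q} {T : ℝ} (h : FanoReaches R y b Δ s s')
    (h' : FanoHaltsBelow R y b Δ T s') : FanoHaltsBelow R y b Δ T s := by
  obtain ⟨w, hw, hT, hr⟩ := h'
  exact ⟨w, hw, hT, h.trans hr⟩

lemma FanoHaltsBelow.mono {s : FanoState Q} {T T' : ℝ} (hT : T ≤ T')
    (h : FanoHaltsBelow R y b Δ T s) : FanoHaltsBelow R y b Δ T' s := by
  obtain ⟨w, hw, hf, hr⟩ := h
  exact ⟨w, hw, hf.trans hT, hr⟩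

/-- Every path from the root to a leaf below `v` contains a node whose path metric exceeds `T`. -/
def BlockedBelow (R : Matrix (Fin m) (Fin m) ℝ) (y : Fin m → ℝ) (b T : ℝ)
    (v : List (Fin Q)) : Prop :=
  ∀ w : List (Fin Q), w.length = m → v <+: w → ∃ u, u <+: w ∧ T < pathMetric R y b u

lemma blockedBelow_of_lt {T : ℝ} {v : List (Fin Q)} (h : T < pathMetric R y b v) :
    BlockedBelow R y b T v :=
  fun _ _ hv => ⟨v, hv, h⟩

lemma blockedBelow_of_children {T : ℝ} {v : List (Fin Q)} (hv : v.length < m)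
    (h : ∀ a, BlockedBelow R y b T (v ++ [a])) : BlockedBelow R y b T v := by
  intro w hw hvw
  obtain ⟨a, ha⟩ := exists_child_prefix hvw (hw ▸ hv)
  exact h a w hw ha

lemma fanoBack_concat_of_lt {v : List (Fin Q)} {a : Fin Q} {T : ℝ}
    (h : T < pathMetric R y b v) :
    fanoBack R y b Δ (v ++ [a]) T = .look (v ++ [a]) (T + Δ) 0 := by
  simp [fanoBack, h]

lemma fanoBack_concat_of_le {v : List (Fin Q)} {a : Fin Q} {T : ℝ} {i : ℕ}
    (ha : (children R y b v)[i]? = some a) (h : pathMetric R y b v ≤ T) :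
    fanoBack R y b Δ (v ++ [a]) T = .look v T (i + 1) := by
  obtain ⟨hi, rfl⟩ := List.getElem?_eq_some_iff.1 ha
  simp [fanoBack, not_lt.2 h, (nodup_children v).idxOf_getElem i hi]

lemma fanoStep_none {v : List (Fin Q)} {T : ℝ} {i : ℕ}
    (h : (children R y b v)[i]? = none) :
    fanoStep R y b Δ (.look v T i) = fanoBack R y b Δ v T := by
  simp only [fanoStep, h]

lemma fanoStep_some {v : List (Fin Q)} {T : ℝ} {i : ℕ} {a : Fin Q}
    (h : (children R y b v)[i]? = some a) :
    fanoStep R y b Δ (.look v T i) =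
      if pathMetric R y b (v ++ [a]) ≤ T then
        if v.length + 1 = m then .halted (v ++ [a])
        else if pathMetric R y b v > T - Δ then
          .look (v ++ [a]) (tighten Δ (pathMetric R y b (v ++ [a])) T) 0
        else .look (v ++ [a]) T 0
      else fanoBack R y b Δ v T := by
  simp only [fanoStep, h]

lemma le_tighten (hΔ : 0 < Δ) {f T : ℝ} (h : f ≤ T) : f ≤ tighten Δ f T := by
  have h1 : (⌊(T - f) / Δ⌋₊ : ℝ) ≤ (T - f) / Δ :=
    Nat.floor_le (div_nonneg (sub_nonneg.2 h) hΔ.le)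
  rw [le_div_iff₀ hΔ] at h1
  simp only [tighten]
  linarith

/-- The outcome of exploring the subtree of `v` with threshold `T`: the decoder announces a leaf of
path metric at most `T`, or it wants to leave `v` with the threshold back at `T`, and
every path through `v` is blocked at `T`. -/
def FanoExplores (R : Matrix (Fin m) (Fin m) ℝ) (y : Fin m → ℝ) (b Δ T : ℝ)
    (v : List (Fin Q)) : Prop :=
  FanoHaltsBelow R y b Δ T (.look v T 0) ∨
    (FanoReaches R y b Δ (.look v T 0) (fanoBack R y b Δ v T) ∧ BlockedBelow R y b T v)

/-- A child entered with a tightened threshold `T - j Δ` is explored again and again, with the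
threshold raised by `Δ` each time, until the threshold is `T` again: only then can the decoder move
back to the parent. -/
lemma fano_child {v : List (Fin Q)} {T : ℝ} {i : ℕ} {a : Fin Q} (hΔ : 0 < Δ)
    (ha : (children R y b v)[i]? = some a) (hv : pathMetric R y b v ≤ T)
    (hexp : ∀ T', pathMetric R y b (v ++ [a]) ≤ T' → FanoExplores R y b Δ T' (v ++ [a])) :
    ∀ j : ℕ, pathMetric R y b (v ++ [a]) ≤ T - j * Δ →
      (j ≠ 0 → T - Δ < pathMetric R y b v) →
      FanoHaltsBelow R y b Δ T (.look (v ++ [a]) (T - j * Δ) 0) ∨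
        (FanoReaches R y b Δ (.look (v ++ [a]) (T - j * Δ) 0) (.look v T (i + 1)) ∧
          BlockedBelow R y b T (v ++ [a])) := by
  intro j
  induction j with
  | zero =>
    intro hc _
    rcases hexp _ hc with h | ⟨h, h'⟩
    · exact Or.inl (h.mono (by simp))
    · simp only [Nat.cast_zero, zero_mul, sub_zero] at h h' ⊢
      rw [fanoBack_concat_of_le ha hv] at h
      exact Or.inr ⟨h, h'⟩
  | succ j ih =>
    intro hc hj
    have hlt := hj (Nat.succ_ne_zero j)
    have hjΔ : 0 ≤ (j : ℝ) * Δ := by positivity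
    push_cast at hc ⊢
    rcases hexp _ hc with h | ⟨h, -⟩
    · exact Or.inl (h.mono (by linarith))
    · rw [fanoBack_concat_of_lt (by linarith),
        show T - ((j : ℝ) + 1) * Δ + Δ = T - j * Δ by ring] at h
      rcases ih (by linarith) (fun _ => hlt) with h1 | ⟨h1, h2⟩
      · exact Or.inl (FanoHaltsBelow.of_reaches h h1)
      · exact Or.inr ⟨h.trans h1, h2⟩

lemma fano_explores (hΔ : 0 < Δ) : ∀ (d : ℕ) (v : List (Fin Q)) (T : ℝ),
    v.length + (d + 1) = m → pathMetric R y b v ≤ T → FanoExplores R y b Δ T v := by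
  intro d
  induction d using Nat.strong_induction_on with
  | _ d ih =>
  intro v T hd hv
  -- `k` children are left, and the paths through the first `i` children are blocked
  have key : ∀ k i : ℕ, i + k = Q →
      (∀ j < i, ∀ a, (children R y b v)[j]? = some a → BlockedBelow R y b T (v ++ [a])) →
      FanoHaltsBelow R y b Δ T (.look v T i) ∨
        (FanoReaches R y b Δ (.look v T i) (fanoBack R y b Δ v T) ∧ BlockedBelow R y b T v) := by
    intro k
    induction k with
    | zero =>
      intro i hi hb
      have hnone : (children R y b v)[i]? = none := by
        rw [List.getElem?_eq_none_iff, length_children]; omega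
      refine Or.inr ⟨?_, blockedBelow_of_children (by omega) fun a => ?_⟩
      · rw [← fanoStep_none hnone]
        exact FanoReaches.step _
      · obtain ⟨j, hj⟩ := exists_getElem?_children (R := R) (y := y) (b := b) v a
        have hjQ : j < (children R y b v).length := (List.getElem?_eq_some_iff.1 hj).1
        rw [length_children] at hjQ
        exact hb j (by omega) a hj
    | succ k ihk =>
      intro i hi hb
      have hiQ : i < (children R y b v).length := by rw [length_children]; omega
      obtain ⟨a, ha⟩ : ∃ a, (children R y b v)[i]? = some a := ⟨_, List.getElem?_eq_getElem hiQ⟩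
      have hstep := FanoReaches.step (R := R) (y := y) (b := b) (Δ := Δ) (.look v T i)
      rw [fanoStep_some ha] at hstep
      split_ifs at hstep with h1 h2 h3
      · exact Or.inl ⟨v ++ [a], by simpa using h2, h1, hstep⟩
      · obtain ⟨d', rfl⟩ : ∃ d', d = d' + 1 := ⟨d - 1, by omega⟩
        have hc := fano_child hΔ ha hv
          (fun T' hT' => ih d' (by omega) (v ++ [a]) T' (by simp; omega) hT') _
          (le_tighten hΔ h1) (fun _ => h3)
        rcases hc with hc | ⟨hc, hblock⟩
        · exact Or.inl (FanoHaltsBelow.of_reaches hstep hc)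
        · rcases ihk (i + 1) (by omega) (fun j hj a' ha' => by
            rcases Nat.lt_succ_iff_lt_or_eq.1 hj with hj | rfl
            · exact hb j hj a' ha'
            · rw [ha] at ha'; cases ha'; exact hblock) with h | ⟨h, h'⟩
          · exact Or.inl (FanoHaltsBelow.of_reaches (hstep.trans hc) h)
          · exact Or.inr ⟨(hstep.trans hc).trans h, h'⟩
      · obtain ⟨d', rfl⟩ : ∃ d', d = d' + 1 := ⟨d - 1, by omega⟩
        have hc := fano_child hΔ ha hv
          (fun T' hT' => ih d' (by omega) (v ++ [a]) T' (by simp; omega) hT') 0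
          (by simpa using h1) (fun h => absurd rfl h)
        simp only [Nat.cast_zero, zero_mul, sub_zero] at hc
        rcases hc with hc | ⟨hc, hblock⟩
        · exact Or.inl (FanoHaltsBelow.of_reaches hstep hc)
        · rcases ihk (i + 1) (by omega) (fun j hj a' ha' => by
            rcases Nat.lt_succ_iff_lt_or_eq.1 hj with hj | rfl
            · exact hb j hj a' ha'
            · rw [ha] at ha'; cases ha'; exact hblock) with h | ⟨h, h'⟩
          · exact Or.inl (FanoHaltsBelow.of_reaches (hstep.trans hc) h)
          · exact Or.inr ⟨(hstep.trans hc).trans h, h'⟩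
      · -- the remaining children are no better than this one
        refine Or.inr ⟨hstep, blockedBelow_of_children (by omega) fun a' => ?_⟩
        obtain ⟨j, hj⟩ := exists_getElem?_children (R := R) (y := y) (b := b) v a'
        rcases lt_or_ge j i with hji | hji
        · exact hb j hji a' hj
        · exact blockedBelow_of_lt
            (lt_of_lt_of_le (not_le.1 h1) (pathMetric_children_mono hji ha hj))
  exact key Q 0 (by omega) (fun j hj => absurd hj (Nat.not_lt_zero j))

/-- The Fano decoder halts, and the path metric of the leaf that it announces exceeds the maximal
path metric along any path from the root to a leaf by at most `Δ`. -/
theorem fano_halts (hm : 0 < m) (hΔ : 0 < Δ) {B : ℝ} {w : List (Fin Q)} (hw : w.length = m)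
    (hB : ∀ u, u <+: w → pathMetric R y b u ≤ B) :
    FanoHaltsBelow R y b Δ (B + Δ) (.look ([] : List (Fin Q)) 0 0) := by
  have hB0 : 0 ≤ B := by simpa [pathMetric_nil] using hB [] List.nil_prefix
  have key : ∀ (n : ℕ) (T : ℝ), 0 ≤ T → T ≤ B + Δ → B - T ≤ n * Δ →
      FanoHaltsBelow R y b Δ (B + Δ) (.look ([] : List (Fin Q)) T 0) := by
    intro n
    induction n with
    | zero =>
      intro T h0 hT hn
      rcases fano_explores (R := R) (y := y) (b := b) hΔ (m - 1) ([] : List (Fin Q)) T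
        (by simp; omega) (by rwa [pathMetric_nil]) with h | ⟨-, h⟩
      · exact h.mono hT
      · obtain ⟨u, hu, hTu⟩ := h w hw List.nil_prefix
        have := hB u hu
        simp only [Nat.cast_zero, zero_mul] at hn
        linarith
    | succ n ih =>
      intro T h0 hT hn
      rcases fano_explores (R := R) (y := y) (b := b) hΔ (m - 1) ([] : List (Fin Q)) T
        (by simp; omega) (by rwa [pathMetric_nil]) with h | ⟨hr, h⟩
      · exact h.mono hT
      · obtain ⟨u, hu, hTu⟩ := h w hw List.nil_prefix
        have := hB u hu
        push_cast at hn
        exact FanoHaltsBelow.of_reaches hr (ih (T + Δ) (by linarith) (by linarith) (by linarith))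
  obtain ⟨n, hn⟩ := exists_nat_ge (B / Δ)
  exact key n 0 le_rfl (by linarith) (by rw [div_le_iff₀ hΔ] at hn; linarith)

/-! ### The stack algorithm -/

/-- An upper bound for the number of rounds that the entry `p` of ACTIVE can still cause: the number
of children of `p.1` not yet generated, weighted so that the weight of a node exceeds the total
weight of its children. -/
def stackWeight (m : ℕ) (p : List (Fin Q) × ℕ) : ℕ :=
  1 + (Q - p.2) * (Q + 2) ^ (m - p.1.length)

/-- The part of the path from the root to the leaf `w` that has been generated ends at the
entry `p`. -/
def IsFrontier (R : Matrix (Fin m) (Fin m) ℝ) (y : Fin m → ℝ) (b : ℝ) (w : List (Fin Q))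
    (p : List (Fin Q) × ℕ) : Prop :=
  p.1 <+: w ∧ (p.1.length < m → ∃ j, p.2 ≤ j ∧ ∃ a, (children R y b p.1)[j]? = some a ∧
    p.1 ++ [a] <+: w)

lemma isFrontier_zero {v w : List (Fin Q)} (hw : w.length = m) (hv : v <+: w) :
    IsFrontier R y b w (v, 0) := by
  refine ⟨hv, fun hlt => ?_⟩
  obtain ⟨a, ha⟩ := exists_child_prefix hv (hw ▸ hlt)
  obtain ⟨j, hj⟩ := exists_getElem?_children (R := R) (y := y) (b := b) v a
  exact ⟨j, Nat.zero_le j, a, hj, ha⟩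

lemma stackCost_le_of_isFrontier {B : ℝ} {w : List (Fin Q)}
    (hB : ∀ u, u <+: w → pathMetric R y b u ≤ B) {p : List (Fin Q) × ℕ} (hpm : p.1.length ≤ m)
    (hp : IsFrontier R y b w p) : stackCost R y b p ≤ B := by
  rcases hpm.eq_or_lt with h | h
  · simp [stackCost, h]
  · obtain ⟨j, hj, a, ha, haw⟩ := hp.2 h
    have hlt : p.2 < (children R y b p.1).length :=
      hj.trans_lt (List.getElem?_eq_some_iff.1 ha).1
    have hsome := List.getElem?_eq_getElem hlt
    simp only [stackCost, h.ne, if_false, hsome]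
    exact EReal.coe_le_coe_iff.2 ((pathMetric_children_mono hj hsome ha).trans (hB _ haw))

lemma stackWeight_child {v : List (Fin Q)} {i : ℕ} (a : Fin Q) (hv : v.length < m) (hi : i < Q) :
    stackWeight m (v ++ [a], 0) + stackWeight m (v, i + 1) < stackWeight m (v, i) := by
  obtain ⟨d, hd⟩ : ∃ d, m - v.length = d + 1 := ⟨m - v.length - 1, by omega⟩
  have hd' : m - (v.length + 1) = d := by omega
  obtain ⟨k, hk⟩ : ∃ k, Q - i = k + 1 := ⟨Q - i - 1, by omega⟩
  have hk' : Q - (i + 1) = k := by omega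
  have hpos : 0 < (Q + 2) ^ d := by positivity
  simp only [stackWeight, List.length_append, List.length_singleton, hd, hd', hk, hk',
    Nat.sub_zero, pow_succ]
  nlinarith

open Classical in
/-- The stack algorithm halts, and the path metric of the leaf that it announces is at most the
maximal path metric along any path from the root to a leaf. -/
theorem stack_halts {B : ℝ} {w : List (Fin Q)} (hw : w.length = m)
    (hB : ∀ u, u <+: w → pathMetric R y b u ≤ B) :
    ∃ w' : List (Fin Q), w'.length = m ∧ pathMetric R y b w' ≤ B ∧
      ∃ t, (stackStep R y b)^[t] (.active [([], 0)]) = .halted w' := by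
  have key : ∀ (n : ℕ) (l : List (List (Fin Q) × ℕ)), (l.map (stackWeight m)).sum ≤ n →
      (∀ p ∈ l, p.1.length ≤ m ∧ pathMetric R y b p.1 ≤ B) →
      (∃ p ∈ l, IsFrontier R y b w p) →
      ∃ w' : List (Fin Q), w'.length = m ∧ pathMetric R y b w' ≤ B ∧
        ∃ t, (stackStep R y b)^[t] (.active l) = .halted w' := by
    intro n
    induction n with
    | zero =>
      intro l hl _ ⟨p, hp, _⟩
      have := List.le_sum_of_mem (List.mem_map_of_mem (f := stackWeight m) hp)
      simp only [stackWeight] at this hl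
      omega
    | succ n ih =>
      intro l hl hall ⟨p, hp, hfr⟩
      let r : List (Fin Q) × ℕ → List (Fin Q) × ℕ → Prop :=
        fun p q => stackCost R y b p ≤ stackCost R y b q
      have : Std.Total r := ⟨fun _ _ => le_total _ _⟩
      have : IsTrans _ r := ⟨fun _ _ _ => le_trans⟩
      have hperm := List.perm_insertionSort r l
      have hsort := List.pairwise_insertionSort r l
      -- it suffices to continue from the state after one round
      have next : ∀ s, stackStep R y b (.active l) = s →
          (∃ w' : List (Fin Q), w'.length = m ∧ pathMetric R y b w' ≤ B ∧
            ∃ t, (stackStep R y b)^[t] s = .halted w') →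
          ∃ w' : List (Fin Q), w'.length = m ∧ pathMetric R y b w' ≤ B ∧
            ∃ t, (stackStep R y b)^[t] (.active l) = .halted w' := by
        rintro s rfl ⟨w', h1, h2, t, ht⟩
        exact ⟨w', h1, h2, t + 1, by rw [Function.iterate_succ_apply, ht]⟩
      rcases hlist : l.insertionSort r with _ | ⟨⟨v, i⟩, rest⟩
      · rw [hlist] at hperm
        rw [← hperm.mem_iff] at hp
        simp at hp
      rw [hlist] at hperm hsort
      have hall' : ∀ q ∈ (v, i) :: rest, q.1.length ≤ m ∧ pathMetric R y b q.1 ≤ B :=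
        fun q hq => hall q (hperm.mem_iff.1 hq)
      have hp' : p ∈ (v, i) :: rest := hperm.mem_iff.2 hp
      have hl' : (((v, i) :: rest).map (stackWeight m)).sum ≤ n + 1 := by
        rwa [(hperm.map _).sum_eq]
      rw [List.map_cons, List.sum_cons] at hl'
      have hstep : stackStep R y b (.active l) = if v.length = m then .halted v
          else match (children R y b v)[i]? with
            | none => .active rest
            | some a => .active ((v ++ [a], 0) :: (v, i + 1) :: rest) := by
        simp only [stackStep]
        change (match l.insertionSort r with
          | [] => _
          | (v, i) :: rest => _) = _
        rw [hlist]
      have hv := hall' (v, i) List.mem_cons_self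
      by_cases hvm : v.length = m
      · rw [if_pos hvm] at hstep
        exact next _ hstep ⟨v, hvm, hv.2, 0, rfl⟩
      rw [if_neg hvm] at hstep
      have hvlt : v.length < m := lt_of_le_of_ne hv.1 hvm
      rcases hch : (children R y b v)[i]? with _ | a
      · rw [hch] at hstep
        refine next _ hstep (ih rest ?_ (fun q hq => hall' q (List.mem_cons_of_mem _ hq))
          ⟨p, ?_, hfr⟩)
        · have : 1 ≤ stackWeight m (v, i) := by simp [stackWeight]
          omega
        · rcases List.mem_cons.1 hp' with rfl | h
          · obtain ⟨j, hj, a, ha, -⟩ := hfr.2 hvlt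
            have h1 : j < (children R y b v).length := (List.getElem?_eq_some_iff.1 ha).1
            rw [List.getElem?_eq_none_iff] at hch
            simp only at hj
            omega
          · exact h
      · rw [hch] at hstep
        have hiQ : i < Q := by
          have := (List.getElem?_eq_some_iff.1 hch).1
          rwa [length_children] at this
        have hle : stackCost R y b (v, i) ≤ stackCost R y b p := by
          rcases List.mem_cons.1 hp' with rfl | h
          · exact le_rfl
          · exact (List.pairwise_cons.1 hsort).1 p h
        have hcost := hle.trans (stackCost_le_of_isFrontier hB (hall p hp).1 hfr)
        simp only [stackCost, hvm, if_false, hch] at hcost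
        refine next _ hstep (ih _ ?_ ?_ ?_)
        · have := stackWeight_child (m := m) a hvlt hiQ
          simp only [List.map_cons, List.sum_cons]
          omega
        · intro q hq
          rcases List.mem_cons.1 hq with rfl | hq
          · exact ⟨by simpa using hvlt, EReal.coe_le_coe_iff.1 hcost⟩
          rcases List.mem_cons.1 hq with rfl | hq
          · exact hv
          · exact hall' q (List.mem_cons_of_mem _ hq)
        · rcases List.mem_cons.1 hp' with rfl | h
          · obtain ⟨j, hj, a', ha', haw⟩ := hfr.2 hvlt
            rcases hj.eq_or_lt with rfl | hj
            · obtain rfl : a = a' := Option.some.inj (hch.symm.trans ha')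
              exact ⟨_, List.mem_cons_self, isFrontier_zero hw haw⟩
            · exact ⟨(v, i + 1), by simp, hfr.1, fun _ => ⟨j, hj, a', ha', haw⟩⟩
          · exact ⟨p, by simp [h], hfr⟩
  refine key _ _ le_rfl ?_ ⟨([], 0), by simp, isFrontier_zero hw List.nil_prefix⟩
  intro p hp
  obtain rfl := List.mem_singleton.1 hp
  exact ⟨Nat.zero_le _, hB [] List.nil_prefix⟩

end TreeSearch

/-! ### Leaves and the squared distance -/

section Metric

variable {Q m : ℕ} {R : Matrix (Fin m) (Fin m) ℝ} {y : Fin m → ℝ} {b : ℝ}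

lemma length_leaf (x : Fin m → Fin Q) : (leaf x).length = m := by simp [leaf]

lemma leaf_injective : Function.Injective (leaf : (Fin m → Fin Q) → List (Fin Q)) := by
  intro x x' h
  have h' := List.ofFn_injective h
  funext i
  simpa using congrFun h' i.rev

lemma exists_eq_leaf {w : List (Fin Q)} (hw : w.length = m) :
    ∃ x : Fin m → Fin Q, w = leaf x := by
  subst hw
  refine ⟨fun l => w.get l.rev, ?_⟩
  simp only [leaf, Fin.rev_rev]
  exact (List.ofFn_get w).symm

lemma branchMetric_eq (v : List (Fin Q)) (l : Fin m) :
    branchMetric R y v l = (y l.rev - ∑ j ∈ Finset.Iic l,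
      R l.rev j.rev * (v[(j : ℕ)]?.map fun a : Fin Q => ((a : ℕ) : ℝ)).getD 0) ^ 2 := by
  have h : ∀ u : List (Fin Q), u.flatMap (fun a => [a.val]) = u.map Fin.val := fun u => by
    induction u <;> simp_all
  simp only [branchMetric, List.pure_def, List.bind_eq_flatMap, h,
    List.getD_eq_getElem?_getD, List.getElem?_map, Option.map_map]
  rfl

/-- Since `R` is upper triangular, the branch metrics along the path to a leaf are the squared
components of the residual. -/
lemma branchMetric_leaf (hR : ∀ i j, j < i → R i j = 0) (x : Fin m → Fin Q) (l : Fin m) :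
    branchMetric R y (leaf x) l = (y l.rev - R.mulVec (toReal x) l.rev) ^ 2 := by
  have h1 : R.mulVec (toReal x) l.rev = ∑ j : Fin m, R l.rev j.rev * toReal x j.rev := by
    simp only [Matrix.mulVec, dotProduct]
    exact (Equiv.sum_comp Fin.revPerm (fun j => R l.rev j * toReal x j)).symm
  rw [branchMetric_eq, h1]
  congr 2
  have h2 : ∀ j : Fin m,
      ((leaf x)[(j : ℕ)]?.map fun a : Fin Q => ((a : ℕ) : ℝ)).getD 0 = toReal x j.rev := by
    intro j
    simp [leaf, toReal]
  simp only [h2]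
  refine Finset.sum_subset (Finset.subset_univ _) fun j _ hj => ?_
  rw [hR _ _ (Fin.rev_lt_rev.2 (by simpa using hj)), zero_mul]

lemma pathMetric_leaf (hR : ∀ i j, j < i → R i j = 0) (x : Fin m → Fin Q) :
    pathMetric R y b (leaf x) = ∑ i, (y i - R.mulVec (toReal x) i) ^ 2 - b * m := by
  rw [pathMetric, length_leaf]
  congr 1
  simp only [Fin.is_lt, Finset.filter_true, branchMetric_leaf hR]
  exact Equiv.sum_comp Fin.revPerm (fun i => (y i - R.mulVec (toReal x) i) ^ 2)

lemma branchMetric_prefix {u w : List (Fin Q)} (h : u <+: w) {l : Fin m}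
    (hl : (l : ℕ) < u.length) : branchMetric R y u l = branchMetric R y w l := by
  obtain ⟨t, rfl⟩ := h
  simp only [branchMetric_eq]
  congr 2
  refine Finset.sum_congr rfl fun j hj => ?_
  have hju : (j : ℕ) < u.length := lt_of_le_of_lt (Fin.le_def.1 (Finset.mem_Iic.1 hj)) hl
  rw [List.getElem?_append_left hju]

lemma pathMetric_prefix_le (hb : 0 ≤ b) (hR : ∀ i j, j < i → R i j = 0) (x : Fin m → Fin Q)
    {u : List (Fin Q)} (hu : u <+: leaf x) :
    pathMetric R y b u ≤ ∑ i, (y i - R.mulVec (toReal x) i) ^ 2 := by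
  have h1 : ∑ l ∈ Finset.univ.filter (fun l : Fin m => (l : ℕ) < u.length), branchMetric R y u l
      ≤ ∑ l : Fin m, branchMetric R y (leaf x) l := by
    rw [Finset.sum_congr rfl fun l hl => branchMetric_prefix hu (Finset.mem_filter.1 hl).2]
    exact Finset.sum_le_sum_of_subset_of_nonneg (Finset.subset_univ _)
      fun _ _ _ => sq_nonneg _
  have h2 : ∑ l : Fin m, branchMetric R y (leaf x) l
      = ∑ i, (y i - R.mulVec (toReal x) i) ^ 2 := by
    simp only [branchMetric_leaf hR]
    exact Equiv.sum_comp Fin.revPerm (fun i => (y i - R.mulVec (toReal x) i) ^ 2)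
  have h3 : 0 ≤ b * u.length := by positivity
  rw [pathMetric]
  linarith

end Metric

/-! ### Errors of the three decoders -/

section Errors

variable {ι : Type} {Q m : ℕ}

lemma received_sub (H : Matrix ι (Fin m) ℝ) (z : ι → ℝ) (x : Fin m → Fin Q) :
    received H z x - H.mulVec (offset Q m) = (H * generator Q m).mulVec (toReal x) + z := by
  simp only [received, Matrix.mulVec_add, Matrix.mulVec_mulVec]
  abel

/-- A decoder announces at most one vector. -/
def IsFunctional (decides : Matrix ι (Fin m) ℝ → (ι → ℝ) → (Fin m → Fin Q) → Prop) : Prop :=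
  ∀ H r x x', decides H r x → decides H r x' → x = x'

lemma mlDecides_isFunctional (ml : Matrix ι (Fin m) ℝ → (ι → ℝ) → (Fin m → Fin Q)) :
    IsFunctional (mlDecides ml) :=
  fun _ _ _ _ h h' => h.symm.trans h'

variable [Fintype ι]

/-- The squared distance from the received vector to the noiseless received vector of a competitor,
whose difference to the transmitted vector is `d`, exceeds the squared norm of the noise `z` by at
most `B`. -/
def IsClose (A : Matrix ι (Fin m) ℝ) (z : ι → ℝ) (B : ℝ) (d : Fin m → ℝ) : Prop :=
  A.mulVec d ⬝ᵥ A.mulVec d + 2 * (z ⬝ᵥ A.mulVec d) ≤ B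

lemma sum_sq_residual (A : Matrix ι (Fin m) ℝ) (z : ι → ℝ) (x x' : Fin m → ℝ) :
    ∑ i, ((A.mulVec x + z) i - A.mulVec x' i) ^ 2 = z ⬝ᵥ z +
      (A.mulVec (x - x') ⬝ᵥ A.mulVec (x - x') + 2 * (z ⬝ᵥ A.mulVec (x - x'))) := by
  simp only [Matrix.mulVec_sub, dotProduct, Pi.sub_apply, Pi.add_apply, Finset.mul_sum,
    ← Finset.sum_add_distrib]
  exact Finset.sum_congr rfl fun i _ => by ring

/-- The QR decomposition changes the squared distances to all noiseless received vectors by the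
same amount. -/
lemma sum_sq_qr_residual {A U : Matrix ι (Fin m) ℝ} {R : Matrix (Fin m) (Fin m) ℝ}
    (h : IsQR A U R) (z : ι → ℝ) (x x' : Fin m → ℝ) :
    ∑ i, (U.transpose.mulVec (A.mulVec x + z) i - R.mulVec x' i) ^ 2 =
      U.transpose.mulVec z ⬝ᵥ U.transpose.mulVec z +
      (A.mulVec (x - x') ⬝ᵥ A.mulVec (x - x') + 2 * (z ⬝ᵥ A.mulVec (x - x'))) := by
  have h1 : U.transpose.mulVec (A.mulVec x + z) = R.mulVec x + U.transpose.mulVec z := by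
    rw [Matrix.mulVec_add, Matrix.mulVec_mulVec, h.eq_mul, ← Matrix.mul_assoc, h.orthonormal,
      Matrix.one_mul]
  have h2 : ∀ v : ι → ℝ, ∀ d : Fin m → ℝ,
      U.transpose.mulVec v ⬝ᵥ R.mulVec d = v ⬝ᵥ A.mulVec d := by
    intro v d
    rw [h.eq_mul, ← Matrix.mulVec_mulVec, Matrix.mulVec_transpose, ← Matrix.dotProduct_mulVec]
  have h3 : ∀ d : Fin m → ℝ, R.mulVec d = U.transpose.mulVec (A.mulVec d) := by
    intro d
    rw [Matrix.mulVec_mulVec, h.eq_mul, ← Matrix.mul_assoc, h.orthonormal, Matrix.one_mul]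
  have h4 : ∀ d : Fin m → ℝ, R.mulVec d ⬝ᵥ R.mulVec d = A.mulVec d ⬝ᵥ A.mulVec d := by
    intro d
    rw [← h2 (A.mulVec d) d, ← h3]
  rw [h1, sum_sq_residual, h4, h2]

/-- A decoder commits a `B`-close error whenever it does not announce the transmitted vector: some
other vector is a close competitor in the sense of `IsClose`. -/
def ErrsClosely (B : ℝ) (decides : Matrix ι (Fin m) ℝ → (ι → ℝ) → (Fin m → Fin Q) → Prop) : Prop :=
  ∀ H z x, ¬ decides H (received H z x) x →
    ∃ x', x' ≠ x ∧ IsClose (H * generator Q m) z B (toReal x - toReal x')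

lemma mlDecides_errsClosely {ml : Matrix ι (Fin m) ℝ → (ι → ℝ) → (Fin m → Fin Q)}
    (hml : IsMLDecoder ml) : ErrsClosely 0 (mlDecides ml) := by
  intro H z x hne
  refine ⟨ml H (received H z x), hne, ?_⟩
  have h := hml H (received H z x) x
  have h1 : ∀ x' : Fin m → Fin Q, mlMetric H (received H z x) x' = ∑ i,
      (((H * generator Q m).mulVec (toReal x) + z) i
        - (H * generator Q m).mulVec (toReal x') i) ^ 2 := by
    intro x'
    simp only [mlMetric, ← received_sub, Pi.sub_apply]
  rw [h1, h1, sum_sq_residual, sum_sq_residual] at h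
  simp only [sub_self, Matrix.mulVec_zero, dotProduct_zero, mul_zero, add_zero] at h
  simp only [IsClose]
  linarith

variable {qr : Matrix ι (Fin m) ℝ → Matrix ι (Fin m) ℝ × Matrix (Fin m) (Fin m) ℝ} {b Δ : ℝ}

/-- A leaf whose path metric is at most the squared norm of the preprocessed noise, up to `C`, is a
close competitor of the transmitted vector. -/
lemma isClose_of_pathMetric_le {H U : Matrix ι (Fin m) ℝ} {R : Matrix (Fin m) (Fin m) ℝ}
    (h : IsQR (H * generator Q m) U R) (z : ι → ℝ) (x x' : Fin m → Fin Q) {C : ℝ}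
    (hle : pathMetric R (treeInput Q U H (received H z x)) b (leaf x') ≤
      ∑ i, (treeInput Q U H (received H z x) i - R.mulVec (toReal x) i) ^ 2 + C) :
    IsClose (H * generator Q m) z (b * m + C) (toReal x - toReal x') := by
  rw [pathMetric_leaf h.upper] at hle
  simp only [treeInput, received_sub, sum_sq_qr_residual h] at hle
  simp only [sub_self, Matrix.mulVec_zero, dotProduct_zero, mul_zero, add_zero] at hle
  simp only [IsClose]
  linarith

lemma stackDecides_errsClosely (hqr : ∀ A, IsQR A (qr A).1 (qr A).2) (hb : 0 ≤ b) :
    ErrsClosely (Q := Q) (b * m) (stackDecides qr b) := by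
  intro H z x hne
  have h := hqr (H * generator Q m)
  obtain ⟨w, hw, hle, t, ht⟩ := stack_halts (b := b) (length_leaf x)
    (fun u hu => pathMetric_prefix_le
      (y := treeInput Q (qr (H * generator Q m)).1 H (received H z x)) hb h.upper x hu)
  obtain ⟨x', rfl⟩ := exists_eq_leaf hw
  refine ⟨x', ?_, ?_⟩
  · rintro rfl
    exact hne ⟨t, ht⟩
  · have := isClose_of_pathMetric_le (b := b) (C := 0) h z x x' (by simpa using hle)
    simpa using this

lemma fanoDecides_errsClosely (hqr : ∀ A, IsQR A (qr A).1 (qr A).2) (hm : 0 < m) (hb : 0 ≤ b)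
    (hΔ : 0 < Δ) : ErrsClosely (Q := Q) (b * m + Δ) (fanoDecides qr b Δ) := by
  intro H z x hne
  have h := hqr (H * generator Q m)
  obtain ⟨w, hw, hle, t, ht⟩ := fano_halts (b := b) hm hΔ (length_leaf x)
    (fun u hu => pathMetric_prefix_le
      (y := treeInput Q (qr (H * generator Q m)).1 H (received H z x)) hb h.upper x hu)
  obtain ⟨x', rfl⟩ := exists_eq_leaf hw
  refine ⟨x', ?_, isClose_of_pathMetric_le h z x x' hle⟩
  rintro rfl
  exact hne ⟨t, ht⟩

lemma eq_of_iterate_eq_fixed {α : Type*} {f : α → α} {s a a' : α} (ha : f a = a) (ha' : f a' = a')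
    (h : ∃ t : ℕ, f^[t] s = a) (h' : ∃ t : ℕ, f^[t] s = a') : a = a' := by
  obtain ⟨t, ht⟩ := h
  obtain ⟨t', ht'⟩ := h'
  have h1 : f^[t' + t] s = a := by
    rw [Function.iterate_add_apply, ht, Function.iterate_fixed ha]
  have h2 : f^[t + t'] s = a' := by
    rw [Function.iterate_add_apply, ht', Function.iterate_fixed ha']
  rw [← h1, ← h2, add_comm]

lemma stackDecides_isFunctional : IsFunctional (Q := Q) (stackDecides qr b) := by
  intro H r x x' h h'
  have := eq_of_iterate_eq_fixed (by rfl) (by rfl) h h'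
  exact leaf_injective (StackState.halted.inj this)

lemma fanoDecides_isFunctional : IsFunctional (Q := Q) (fanoDecides qr b Δ) := by
  intro H r x x' h h'
  have := eq_of_iterate_eq_fixed (by rfl) (by rfl) h h'
  exact leaf_injective (FanoState.halted.inj this)

end Errors

/-! ### Product measures -/

section ProductMeasures

variable {ι : Type*} [Fintype ι] {X : ι → Type*} [∀ i, MeasurableSpace (X i)]

lemma lintegral_pi_prod (μ : ∀ i, Measure (X i)) [∀ i, SigmaFinite (μ i)]
    {f : ∀ i, X i → ENNReal} (hf : ∀ i, Measurable (f i)) :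
    ∫⁻ x, ∏ i, f i (x i) ∂Measure.pi μ = ∏ i, ∫⁻ t, f i t ∂μ i := by
  classical
  have hmeas : Measurable fun x : ∀ i, X i => ∏ i, f i (x i) :=
    Finset.measurable_fun_prod _ fun i _ => (hf i).comp (measurable_pi_apply i)
  have key : ∀ s : Finset ι, ∀ x : ∀ i, X i,
      lmarginal μ s (fun x => ∏ i, f i (x i)) x
        = (∏ i ∈ s, ∫⁻ t, f i t ∂μ i) * ∏ i ∈ sᶜ, f i (x i) := by
    intro s
    induction s using Finset.induction_on with
    | empty => intro x; simp [lmarginal_empty]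
    | insert i s hi ih =>
      intro x
      rw [lmarginal_insert _ hmeas hi]
      have hsplit : sᶜ = insert i (insert i s)ᶜ := by
        ext j; by_cases hj : j = i <;> simp_all
      have hint : ∀ t, lmarginal μ s (fun x => ∏ i, f i (x i)) (Function.update x i t)
          = ((∏ i ∈ s, ∫⁻ t, f i t ∂μ i) * ∏ j ∈ (insert i s)ᶜ, f j (x j)) * f i t := by
        intro t
        rw [ih, hsplit, Finset.prod_insert (by simp), Function.update_self]
        have : ∏ j ∈ (insert i s)ᶜ, f j (Function.update x i t j)
            = ∏ j ∈ (insert i s)ᶜ, f j (x j) := by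
          refine Finset.prod_congr rfl fun j hj => ?_
          have hji : j ≠ i := by
            rintro rfl
            simp at hj
          rw [Function.update_of_ne hji]
        rw [this]
        ring
      simp only [hint]
      rw [lintegral_const_mul _ (hf i), Finset.prod_insert hi]
      ring
  rcases isEmpty_or_nonempty (∀ i, X i) with h | ⟨⟨x⟩⟩
  · obtain ⟨i, hi⟩ := isEmpty_pi.1 h
    rw [lintegral_of_isEmpty]
    refine (Finset.prod_eq_zero (Finset.mem_univ i) ?_).symm
    exact lintegral_of_isEmpty _ _
  · rw [lintegral_eq_lmarginal_univ x, key]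
    simp

lemma measure_pi_mono {μ ν : ∀ i, Measure (X i)} [∀ i, SigmaFinite (μ i)] (h : ∀ i, μ i ≤ ν i) :
    Measure.pi μ ≤ Measure.pi ν := by
  refine Measure.le_iff.2 fun s hs => ?_
  have h1 : (Measure.pi μ).toOuterMeasure ≤ OuterMeasure.pi fun i => (ν i).toOuterMeasure := by
    refine OuterMeasure.le_pi.2 fun t _ => ?_
    simp only [Measure.coe_toOuterMeasure, Measure.pi_pi]
    exact Finset.prod_le_prod' fun i _ => h i (t i)
  calc Measure.pi μ s ≤ OuterMeasure.pi (fun i => (ν i).toOuterMeasure) s := h1 s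
    _ = Measure.pi ν s := by rw [Measure.pi, toMeasure_apply _ _ hs]

lemma measure_pi_smul (μ : ∀ i, Measure (X i)) [∀ i, IsFiniteMeasure (μ i)] {c : ENNReal}
    (hc : c ≠ ⊤) : Measure.pi (fun i => c • μ i) = c ^ Fintype.card ι • Measure.pi μ := by
  have : ∀ i, IsFiniteMeasure (c • μ i) := fun i => Measure.smul_finite _ hc
  refine (Measure.pi_eq fun s _ => ?_)
  simp [Measure.pi_pi, Finset.prod_mul_distrib]

end ProductMeasures

/-! ### The complex Gaussian law -/

section ComplexGaussian

lemma gaussianReal_le_volume : gaussianReal 0 (1 / 2) ≤ (volume : Measure ℝ) := by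
  rw [gaussianReal_of_var_ne_zero _ (by norm_num)]
  calc volume.withDensity (gaussianPDF 0 (1 / 2)) ≤ volume.withDensity 1 := by
        refine withDensity_mono (Eventually.of_forall fun x => ?_)
        rw [gaussianPDF, Pi.one_apply, ENNReal.ofReal_le_one, gaussianPDFReal]
        refine mul_le_one₀ (inv_le_one_of_one_le₀ ?_) (Real.exp_pos _).le
          (Real.exp_le_one_iff.2 ?_)
        · rw [Real.one_le_sqrt]
          push_cast
          nlinarith [Real.pi_gt_three]
        · push_cast
          nlinarith [sq_nonneg (x - 0)]
    _ = volume := withDensity_one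

lemma exists_volume_restrict_le_gaussianReal : ∃ C : ENNReal, C ≠ ⊤ ∧
    (volume : Measure ℝ).restrict (Set.Icc (-2) 2) ≤ C • gaussianReal 0 (1 / 2) := by
  set c := gaussianPDF 0 (1 / 2) 2 with hc
  have hc0 : c ≠ 0 := (gaussianPDF_pos 0 (by norm_num) 2).ne'
  have hct : c ≠ ⊤ := gaussianPDF_lt_top.ne
  refine ⟨c⁻¹, ENNReal.inv_ne_top.2 hc0, Measure.le_iff.2 fun s hs => ?_⟩
  rw [Measure.restrict_apply hs, Measure.smul_apply, smul_eq_mul, mul_comm,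
    ← div_eq_mul_inv, ENNReal.le_div_iff_mul_le (Or.inl hc0) (Or.inl hct),
    gaussianReal_of_var_ne_zero _ (by norm_num), withDensity_apply _ hs]
  have hm : MeasurableSet (s ∩ Set.Icc (-2 : ℝ) 2) := hs.inter measurableSet_Icc
  calc volume (s ∩ Set.Icc (-2 : ℝ) 2) * c = ∫⁻ _ in s ∩ Set.Icc (-2 : ℝ) 2, c := by
        rw [setLIntegral_const, mul_comm]
    _ ≤ ∫⁻ x in s ∩ Set.Icc (-2 : ℝ) 2, gaussianPDF 0 (1 / 2) x := by
        refine setLIntegral_mono' hm fun x hx => ?_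
        rw [hc]
        refine ENNReal.ofReal_le_ofReal ?_
        rw [gaussianPDFReal, gaussianPDFReal]
        refine mul_le_mul_of_nonneg_left (Real.exp_le_exp.2 ?_) (by positivity)
        push_cast
        nlinarith [hx.2.1, hx.2.2]
    _ ≤ _ := lintegral_mono_set Set.inter_subset_left

lemma map_prod_volume_eq : ((volume : Measure ℝ).prod volume).map
    (fun p : ℝ × ℝ => Complex.equivRealProdCLM.symm p) = (volume : Measure ℂ) :=
  Complex.volume_preserving_equiv_real_prod.symm.map_eq

lemma measurable_equivRealProd_symm :
    Measurable fun p : ℝ × ℝ => Complex.equivRealProdCLM.symm p :=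
  Complex.equivRealProdCLM.symm.continuous.measurable

lemma complexGaussian_le_volume : complexGaussian ≤ volume := by
  rw [complexGaussian, ← map_prod_volume_eq]
  exact Measure.map_mono (Measure.prod_mono gaussianReal_le_volume gaussianReal_le_volume)
    measurable_equivRealProd_symm

lemma exists_volume_restrict_le_complexGaussian : ∃ C : ENNReal, C ≠ ⊤ ∧
    (volume : Measure ℂ).restrict (Metric.closedBall 0 2) ≤ C • complexGaussian := by
  obtain ⟨C, hC, h⟩ := exists_volume_restrict_le_gaussianReal
  have : IsFiniteMeasure (C • gaussianReal 0 (1 / 2)) := Measure.smul_finite _ hC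
  refine ⟨C * C, ENNReal.mul_ne_top hC hC, ?_⟩
  have h1 : (C * C) • complexGaussian = ((C • gaussianReal 0 (1 / 2)).prod
      (C • gaussianReal 0 (1 / 2))).map (fun p : ℝ × ℝ => Complex.equivRealProdCLM.symm p) := by
    rw [complexGaussian, ← Measure.map_smul, Measure.prod_smul_left, Measure.prod_smul_right,
      smul_smul]
  have h2 := Measure.map_mono (Measure.prod_mono h h) measurable_equivRealProd_symm
  rw [← h1, Measure.prod_restrict] at h2
  refine le_trans (Measure.le_iff.2 fun s hs => ?_) h2
  rw [Measure.map_apply measurable_equivRealProd_symm hs, Measure.restrict_apply hs,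
    Measure.restrict_apply (measurable_equivRealProd_symm hs), ← map_prod_volume_eq,
    Measure.map_apply measurable_equivRealProd_symm (hs.inter measurableSet_closedBall)]
  refine measure_mono fun p hp => ⟨hp.1, ?_⟩
  have hp2 : ‖Complex.equivRealProdCLM.symm p‖ ≤ 2 := by simpa using hp.2
  have hre := (Complex.abs_re_le_norm _).trans hp2
  have him := (Complex.abs_im_le_norm _).trans hp2
  exact ⟨abs_le.1 hre, abs_le.1 him⟩

lemma exists_le_complexGaussian_closedBall : ∃ c : ℝ, 0 < c ∧ ∀ r : ℝ, 0 ≤ r → r ≤ 1 →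
    c * r ^ 2 ≤ complexGaussian.real (Metric.closedBall 0 r) := by
  obtain ⟨C, hC, h⟩ := exists_volume_restrict_le_complexGaussian
  refine ⟨Real.pi / (C.toReal + 1), by positivity, fun r hr hr1 => ?_⟩
  have h1 := h (Metric.closedBall 0 r)
  rw [Measure.restrict_apply measurableSet_closedBall, Set.inter_eq_left.2
    (Metric.closedBall_subset_closedBall (by linarith)), Complex.volume_closedBall,
    Measure.smul_apply, smul_eq_mul] at h1
  have h2 := ENNReal.toReal_mono (ENNReal.mul_ne_top hC (measure_ne_top _ _)) h1
  simp only [ENNReal.toReal_mul, ENNReal.toReal_pow, ENNReal.toReal_ofReal hr,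
    ENNReal.coe_toReal, NNReal.coe_real_pi] at h2
  have h3 : 0 ≤ complexGaussian.real (Metric.closedBall 0 r) := measureReal_nonneg
  rw [div_mul_eq_mul_div, div_le_iff₀ (by positivity)]
  simp only [Measure.real] at h3 ⊢
  linarith

/-- A shift by a vector of length at most `1` increases the Gaussian measure of a subset of the
unit ball by at most a constant factor. -/
lemma exists_map_add_complexGaussian_le : ∃ C : ENNReal, C ≠ ⊤ ∧ ∀ a : ℂ, ‖a‖ ≤ 1 →
    (complexGaussian.restrict (Metric.closedBall 0 1)).map (fun z => z + a)
      ≤ C • complexGaussian := by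
  obtain ⟨C, hC, h⟩ := exists_volume_restrict_le_complexGaussian
  refine ⟨C, hC, fun a ha => le_trans (Measure.le_iff.2 fun s hs => ?_) h⟩
  have hm : Measurable fun z : ℂ => z + a := measurable_add_const a
  rw [Measure.map_apply hm hs, Measure.restrict_apply (hm hs), Measure.restrict_apply hs]
  refine (complexGaussian_le_volume _).trans ?_
  rw [← measure_preimage_add_right volume a (s ∩ _)]
  refine measure_mono fun z hz => ⟨hz.1, ?_⟩
  have hz2 : ‖z‖ ≤ 1 := by simpa using hz.2
  simpa using (norm_add_le z a).trans (by linarith)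

lemma lintegral_exp_gaussianReal (t : ℝ) :
    ∫⁻ x, ENNReal.ofReal (Real.exp (t * x)) ∂gaussianReal 0 (1 / 2)
      = ENNReal.ofReal (Real.exp (t ^ 2 / 4)) := by
  rw [← ofReal_integral_eq_lintegral_ofReal (integrable_exp_mul_gaussianReal t)
    (Eventually.of_forall fun x => (Real.exp_pos _).le)]
  have h := mgf_gaussianReal (p := gaussianReal 0 (1 / 2)) (X := id) Measure.map_id t
  simp only [mgf, id] at h
  rw [h]
  congr 2
  push_cast
  ring

lemma lintegral_exp_complexGaussian (s t : ℝ) :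
    ∫⁻ z, ENNReal.ofReal (Real.exp (s * z.re + t * z.im)) ∂complexGaussian
      = ENNReal.ofReal (Real.exp ((s ^ 2 + t ^ 2) / 4)) := by
  rw [complexGaussian, lintegral_map (by fun_prop) measurable_equivRealProd_symm]
  simp only [Complex.equivRealProdCLM_symm_apply_re, Complex.equivRealProdCLM_symm_apply_im,
    Real.exp_add, ENNReal.ofReal_mul (Real.exp_pos _).le]
  rw [lintegral_prod_mul (f := fun x => ENNReal.ofReal (Real.exp (s * x)))
      (g := fun x => ENNReal.ofReal (Real.exp (t * x))) (by fun_prop) (by fun_prop),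
    lintegral_exp_gaussianReal,
    lintegral_exp_gaussianReal, ← ENNReal.ofReal_mul (Real.exp_pos _).le, ← Real.exp_add,
    add_div]

lemma lintegral_exp_neg_sq_complexGaussian_le {a : ℝ} (ha : 0 < a) {δ : ℂ} (hδ : 1 ≤ ‖δ‖) (w : ℂ) :
    ∫⁻ z, ENNReal.ofReal (Real.exp (-a * ‖z * δ + w‖ ^ 2)) ∂complexGaussian
      ≤ ENNReal.ofReal (Real.pi / a) := by
  have hδ0 : δ ≠ 0 := by
    rintro rfl
    simp at hδ
    linarith
  calc ∫⁻ z, ENNReal.ofReal (Real.exp (-a * ‖z * δ + w‖ ^ 2)) ∂complexGaussian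
      ≤ ∫⁻ z, ENNReal.ofReal (Real.exp (-a * ‖z * δ + w‖ ^ 2)) :=
        lintegral_mono' complexGaussian_le_volume le_rfl
    _ ≤ ∫⁻ z : ℂ, ENNReal.ofReal (Real.exp (-a * ‖z + w / δ‖ ^ 2)) := by
        refine lintegral_mono fun z => ENNReal.ofReal_le_ofReal (Real.exp_le_exp.2 ?_)
        have h1 : z * δ + w = (z + w / δ) * δ := by field_simp
        rw [h1, norm_mul, mul_pow]
        have h2 : 1 ≤ ‖δ‖ ^ 2 := one_le_pow₀ hδ
        have h3 : 0 ≤ a * ‖z + w / δ‖ ^ 2 := by positivity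
        nlinarith
    _ = ∫⁻ z : ℂ, ENNReal.ofReal (Real.exp (-a * ‖z‖ ^ 2)) :=
        lintegral_add_right_eq_self
          (fun z : ℂ => ENNReal.ofReal (Real.exp (-a * ‖z‖ ^ 2))) (w / δ)
    _ = ENNReal.ofReal (Real.pi / a) := by
        have h := GaussianFourier.integral_rexp_neg_mul_sq_norm (V := ℂ) ha
        rw [Complex.finrank_real_complex] at h
        norm_num at h
        have hi : Integrable fun z : ℂ => Real.exp (-a * ‖z‖ ^ 2) := by
          by_contra hni
          have h0 := integral_undef hni
          simp only [neg_mul] at h0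
          rw [h] at h0
          exact (div_pos Real.pi_pos ha).ne' h0
        rw [← ofReal_integral_eq_lintegral_ofReal hi
          (Eventually.of_forall fun _ => (Real.exp_pos _).le)]
        simp only [neg_mul]
        rw [h]

/-- A nonzero linear combination of complex Gaussian variables is close to zero only with a
probability proportional to the area. -/
lemma lintegral_exp_neg_sq_sum_le {M : ℕ} {a : ℝ} (ha : 0 < a) {δ : Fin M → ℂ} {j₀ : Fin M}
    (hδ : 1 ≤ ‖δ j₀‖) :
    ∫⁻ h, ENNReal.ofReal (Real.exp (-a * ‖∑ j, h j * δ j‖ ^ 2))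
      ∂(Measure.pi fun _ : Fin M => complexGaussian) ≤ ENNReal.ofReal (Real.pi / a) := by
  have hc : ENNReal.ofReal (Real.pi / a) = ∫⁻ _, ENNReal.ofReal (Real.pi / a)
      ∂(Measure.pi fun _ : Fin M => complexGaussian) := by simp
  rw [hc]
  refine lintegral_le_of_lmarginal_le {j₀} (by fun_prop) (by fun_prop) ?_
  rw [lmarginal_singleton, lmarginal_singleton]
  intro x
  simp only [lintegral_const, measure_univ, mul_one]
  have h1 : ∀ u : ℂ, ∑ j, Function.update x j₀ u j * δ j
      = u * δ j₀ + ∑ j ∈ Finset.univ.erase j₀, x j * δ j := by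
    intro u
    rw [← Finset.add_sum_erase _ _ (Finset.mem_univ j₀), Function.update_self]
    congr 1
    refine Finset.sum_congr rfl fun j hj => ?_
    rw [Function.update_of_ne (Finset.ne_of_mem_erase hj)]
  simp only [h1]
  exact lintegral_exp_neg_sq_complexGaussian_le ha hδ _

end ComplexGaussian

/-! ### The complex form of the channel -/

section Channel

variable {N M Q : ℕ}

instance (N M : ℕ) : IsProbabilityMeasure (channelLaw N M) := by
  unfold channelLaw
  infer_instance

/-- The factor `κ √(ρ / M)` by which the complex channel scales a difference of information
vectors. -/
def gain (Q M : ℕ) (ρ : ℝ) : ℝ := kappa Q * Real.sqrt (ρ / M)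

/-- A real vector in `ℝ^{2M}` as a vector in `ℂ^M`: the first half holds the real parts. -/
def toComplex (d : Fin (M + M) → ℝ) : Fin M → ℂ :=
  fun j => ⟨d (Fin.castAdd M j), d (Fin.natAdd M j)⟩

/-- The noiseless difference of two received complex vectors, for the difference `d` of the
information vectors. -/
def complexSignal (Q : ℕ) (ρ : ℝ) (h : Fin N → Fin M → ℂ) (d : Fin (M + M) → ℝ) : Fin N → ℂ :=
  fun i => (gain Q M ρ : ℂ) * ∑ j, h i j * toComplex d j

lemma measurable_complexSignal (ρ : ℝ) (d : Fin (M + M) → ℝ) (i : Fin N) :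
    Measurable fun h : Fin N → Fin M → ℂ => complexSignal Q ρ h d i := by
  unfold complexSignal
  fun_prop

lemma realNoise_complexSignal (ρ : ℝ) (h : Fin N → Fin M → ℂ) (d : Fin (M + M) → ℝ) :
    realNoise (complexSignal Q ρ h d) = (realChannel ρ h * generator Q (M + M)).mulVec d := by
  have hs : Real.sqrt (2 * (ρ / M)) = Real.sqrt 2 * Real.sqrt (ρ / M) :=
    Real.sqrt_mul (by norm_num) _
  funext k
  rw [generator, Matrix.mul_smul, Matrix.mul_one, Matrix.smul_mulVec, realChannel,
    Matrix.smul_mulVec]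
  simp only [Pi.smul_apply, smul_eq_mul, Matrix.mulVec, dotProduct, Fin.sum_univ_add]
  rcases k with i | i
  · simp only [realNoise, Pi.smul_apply, Sum.elim_inl, smul_eq_mul, complexSignal,
      Complex.re_ofReal_mul, Complex.re_sum]
    simp only [gain, Complex.mul_re, toComplex, hs,
      Matrix.submatrix_apply, id, finSumFinEquiv_symm_apply_castAdd,
      finSumFinEquiv_symm_apply_natAdd, Matrix.fromBlocks_apply₁₁, Matrix.fromBlocks_apply₁₂,
      Matrix.of_apply, Matrix.neg_apply, ← Finset.sum_add_distrib]
    simp only [neg_mul, ← sub_eq_add_neg]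
    ring
  · simp only [realNoise, Pi.smul_apply, Sum.elim_inr, smul_eq_mul, complexSignal,
      Complex.im_ofReal_mul, Complex.im_sum]
    simp only [gain, Complex.mul_im, toComplex, hs,
      Matrix.submatrix_apply, id, finSumFinEquiv_symm_apply_castAdd,
      finSumFinEquiv_symm_apply_natAdd, Matrix.fromBlocks_apply₂₁, Matrix.fromBlocks_apply₂₂,
      Matrix.of_apply, ← Finset.sum_add_distrib]
    simp only [add_comm (_ * (d (Fin.natAdd M _)))]
    ring

lemma realNoise_add (z w : Fin N → ℂ) : realNoise (z + w) = realNoise z + realNoise w := by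
  funext k
  rcases k with i | i <;> simp [realNoise, mul_add]

lemma realNoise_dotProduct (z w : Fin N → ℂ) :
    realNoise z ⬝ᵥ realNoise w = 2 * ∑ i, ((z i).re * (w i).re + (z i).im * (w i).im) := by
  have h2 : Real.sqrt 2 * Real.sqrt 2 = 2 := Real.mul_self_sqrt (by norm_num)
  simp only [dotProduct, Fintype.sum_sum_type, realNoise, Pi.smul_apply, smul_eq_mul,
    Sum.elim_inl, Sum.elim_inr, ← Finset.sum_add_distrib, Finset.mul_sum]
  refine Finset.sum_congr rfl fun i _ => ?_
  linear_combination ((z i).re * (w i).re + (z i).im * (w i).im) * h2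

/-- Transmission of `x` and of `x'` cannot be told apart if the noise differs by the
corresponding signal difference. -/
lemma received_add_complexSignal (ρ : ℝ) (h : Fin N → Fin M → ℂ) (z : Fin N → ℂ)
    (x x' : Fin (M + M) → Fin Q) :
    received (realChannel ρ h) (realNoise (z + complexSignal Q ρ h (toReal x - toReal x'))) x'
      = received (realChannel ρ h) (realNoise z) x := by
  rw [realNoise_add, realNoise_complexSignal]
  simp only [received, Matrix.mulVec_add, Matrix.mulVec_sub, Matrix.mulVec_mulVec]
  abel

lemma kappa_pos (hQ : 2 ≤ Q) : 0 < kappa Q := by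
  have : (2 : ℝ) ≤ Q := by exact_mod_cast hQ
  exact Real.sqrt_pos.2 (div_pos (by norm_num) (by nlinarith))

lemma gain_sq {ρ : ℝ} (hρ : 0 ≤ ρ) : gain Q M ρ ^ 2 = kappa Q ^ 2 / M * ρ := by
  rw [gain, mul_pow, Real.sq_sqrt (by positivity)]
  ring

lemma gain_pos (hQ : 2 ≤ Q) (hM : 1 ≤ M) {ρ : ℝ} (hρ : 0 < ρ) : 0 < gain Q M ρ :=
  mul_pos (kappa_pos hQ) (Real.sqrt_pos.2 (div_pos hρ (by exact_mod_cast hM)))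

end Channel

/-! ### The upper bound: pairwise close errors -/

section UpperBound

variable {N M Q : ℕ}

/-- The integrand of the Chernoff bound with parameter `1 / 2`, for one receive antenna with
noiseless difference `w` and noise `z`. -/
def chernoff (w z : ℂ) : ENNReal :=
  ENNReal.ofReal (Real.exp (-(‖w‖ ^ 2 + 2 * (z.re * w.re + z.im * w.im)) / 2))

lemma lintegral_chernoff (w : ℂ) :
    ∫⁻ z, chernoff w z ∂complexGaussian = ENNReal.ofReal (Real.exp (-(1 / 4) * ‖w‖ ^ 2)) := by
  have h1 : ∀ z, chernoff w z = ENNReal.ofReal (Real.exp (-‖w‖ ^ 2 / 2)) *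
      ENNReal.ofReal (Real.exp (-w.re * z.re + -w.im * z.im)) := by
    intro z
    rw [← ENNReal.ofReal_mul (Real.exp_pos _).le, ← Real.exp_add, chernoff]
    congr 2
    ring
  simp only [h1]
  rw [lintegral_const_mul _ (by fun_prop), lintegral_exp_complexGaussian,
    ← ENNReal.ofReal_mul (Real.exp_pos _).le, ← Real.exp_add]
  congr 2
  rw [Complex.sq_norm, Complex.normSq_apply]
  ring

lemma measurable_chernoff : Measurable (Function.uncurry chernoff) := by
  unfold chernoff Function.uncurry
  fun_prop

lemma measurable_chernoff_complexSignal (ρ : ℝ) (d : Fin (M + M) → ℝ) (i : Fin N) :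
    Measurable fun ω : (Fin N → Fin M → ℂ) × (Fin N → ℂ) =>
      chernoff (complexSignal Q ρ ω.1 d i) (ω.2 i) := by
  have h1 : Measurable fun ω : (Fin N → Fin M → ℂ) × (Fin N → ℂ) => complexSignal Q ρ ω.1 d i :=
    (measurable_complexSignal (Q := Q) ρ d i).comp measurable_fst
  have h2 : Measurable fun ω : (Fin N → Fin M → ℂ) × (Fin N → ℂ) => ω.2 i :=
    (measurable_pi_apply i).comp measurable_snd
  unfold chernoff
  fun_prop

/-- By independence of the rows of the channel, a close error has probability at most of order
`ρ ^ (-N)`: every row contributes a factor `1 / ρ`. -/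
lemma channelLaw_isClose_le (hQ : 2 ≤ Q) (hM : 1 ≤ M) {ρ : ℝ} (hρ : 0 < ρ) (B : ℝ)
    {d : Fin (M + M) → ℝ} {k : Fin (M + M)} (hd : 1 ≤ |d k|) :
    (channelLaw N M).real
        {ω | IsClose (realChannel ρ ω.1 * generator Q (M + M)) (realNoise ω.2) B d}
      ≤ Real.exp (B / 4) * (4 * Real.pi * M / kappa Q ^ 2) ^ N * (ρ ^ N)⁻¹ := by
  set g := gain Q M ρ with hg
  have hg0 : 0 < g := gain_pos hQ hM hρ
  obtain ⟨j₀, hj₀⟩ : ∃ j₀, 1 ≤ ‖toComplex d j₀‖ := by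
    induction k using Fin.addCases with
    | left j => exact ⟨j, hd.trans (Complex.abs_re_le_norm (toComplex d j))⟩
    | right j => exact ⟨j, hd.trans (Complex.abs_im_le_norm (toComplex d j))⟩
  let F : (Fin N → Fin M → ℂ) × (Fin N → ℂ) → ENNReal :=
    fun ω => ∏ i, chernoff (complexSignal Q ρ ω.1 d i) (ω.2 i)
  have hF : Measurable F := by
    exact Finset.measurable_fun_prod _ fun i _ => measurable_chernoff_complexSignal ρ d i
  have hsub : {ω : (Fin N → Fin M → ℂ) × (Fin N → ℂ) |
      IsClose (realChannel ρ ω.1 * generator Q (M + M)) (realNoise ω.2) B d}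
      ⊆ {ω | ENNReal.ofReal (Real.exp (-B / 4)) ≤ F ω} := by
    intro ω hω
    simp only [Set.mem_ofPred_eq, IsClose, ← realNoise_complexSignal,
      realNoise_dotProduct] at hω
    simp only [Set.mem_ofPred_eq, F, chernoff]
    rw [← ENNReal.ofReal_prod_of_nonneg fun _ _ => (Real.exp_pos _).le, ← Real.exp_sum]
    refine ENNReal.ofReal_le_ofReal (Real.exp_le_exp.2 ?_)
    simp only [Complex.sq_norm, Complex.normSq_apply]
    rw [← Finset.sum_div, Finset.sum_neg_distrib, Finset.sum_add_distrib, ← Finset.mul_sum]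
    linarith
  have hint : ∫⁻ ω, F ω ∂channelLaw N M ≤ ENNReal.ofReal (4 * Real.pi / g ^ 2) ^ N := by
    rw [channelLaw, lintegral_prod _ hF.aemeasurable]
    calc ∫⁻ h, ∫⁻ z, F (h, z) ∂(Measure.pi fun _ => complexGaussian)
          ∂(Measure.pi fun _ => Measure.pi fun _ => complexGaussian)
        = ∫⁻ h, ∏ i : Fin N,
            ENNReal.ofReal (Real.exp (-(g ^ 2 / 4) * ‖∑ j, h i j * toComplex d j‖ ^ 2))
            ∂(Measure.pi fun _ : Fin N => Measure.pi fun _ : Fin M => complexGaussian) := by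
          refine lintegral_congr fun h => ?_
          have hm : ∀ w, Measurable (chernoff w) :=
            fun w => measurable_chernoff.of_uncurry_left
          simp only [F]
          rw [lintegral_pi_prod (fun _ => complexGaussian) (fun i => hm _)]
          refine Finset.prod_congr rfl fun i _ => ?_
          rw [lintegral_chernoff, complexSignal, norm_mul, mul_pow, Complex.norm_real,
            Real.norm_eq_abs, sq_abs]
          congr 2
          ring
      _ = ∏ _i : Fin N, ∫⁻ h,
            ENNReal.ofReal (Real.exp (-(g ^ 2 / 4) * ‖∑ j, h j * toComplex d j‖ ^ 2))
            ∂(Measure.pi fun _ : Fin M => complexGaussian) :=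
          lintegral_pi_prod (fun _ : Fin N => Measure.pi fun _ : Fin M => complexGaussian)
            (f := fun _ h =>
              ENNReal.ofReal (Real.exp (-(g ^ 2 / 4) * ‖∑ j, h j * toComplex d j‖ ^ 2)))
            (fun _ => by fun_prop)
      _ ≤ ∏ _i : Fin N, ENNReal.ofReal (Real.pi / (g ^ 2 / 4)) :=
          Finset.prod_le_prod' fun _ _ => lintegral_exp_neg_sq_sum_le (by positivity) hj₀
      _ = ENNReal.ofReal (4 * Real.pi / g ^ 2) ^ N := by
          rw [Finset.prod_const, Finset.card_univ, Fintype.card_fin]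
          congr 2
          field_simp
  have hmarkov := (mul_meas_ge_le_lintegral hF (ENNReal.ofReal (Real.exp (-B / 4)))
    (μ := channelLaw N M)).trans hint
  have hmain := (mul_le_mul_right (measure_mono hsub)
    (ENNReal.ofReal (Real.exp (-B / 4)))).trans hmarkov
  have hreal := ENNReal.toReal_mono (ENNReal.pow_ne_top ENNReal.ofReal_ne_top) hmain
  rw [ENNReal.toReal_mul, ENNReal.toReal_ofReal (Real.exp_pos _).le, ENNReal.toReal_pow,
    ENNReal.toReal_ofReal (by positivity), hg, gain_sq hρ.le] at hreal
  have hk := kappa_pos hQ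
  have hM0 : (0 : ℝ) < M := by exact_mod_cast hM
  have hconst : (4 * Real.pi / (kappa Q ^ 2 / M * ρ)) ^ N
      = (4 * Real.pi * M / kappa Q ^ 2) ^ N * (ρ ^ N)⁻¹ := by
    rw [← inv_pow, ← mul_pow]
    congr 1
    field_simp
  rw [hconst, neg_div, Real.exp_neg, inv_mul_le_iff₀ (Real.exp_pos _), ← mul_assoc] at hreal
  exact hreal

lemma exists_one_le_abs_sub {m : ℕ} {x x' : Fin m → Fin Q} (h : x' ≠ x) :
    ∃ k, 1 ≤ |(toReal x - toReal x') k| := by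
  obtain ⟨k, hk⟩ := Function.ne_iff.1 h
  refine ⟨k, ?_⟩
  have h1 : ((x k : ℕ) : ℤ) - (x' k : ℕ) ≠ 0 := by
    intro h0
    exact hk (Fin.ext (by omega))
  have h2 := Int.one_le_abs h1
  simp only [Pi.sub_apply, toReal]
  exact_mod_cast h2

theorem frameErrorRate_le (hQ : 2 ≤ Q) (hM : 1 ≤ M) {B : ℝ}
    {decides : Matrix (Fin N ⊕ Fin N) (Fin (M + M)) ℝ → (Fin N ⊕ Fin N → ℝ) →
      (Fin (M + M) → Fin Q) → Prop} (h : ErrsClosely B decides) :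
    ∃ C : ℝ, ∀ ρ : ℝ, 0 < ρ → frameErrorRate decides ρ ≤ C * (ρ ^ N)⁻¹ := by
  classical
  set K : ℝ := Real.exp (B / 4) * (4 * Real.pi * M / kappa Q ^ 2) ^ N
  refine ⟨(∑ x : Fin (M + M) → Fin Q, ∑ x' ∈ Finset.univ.filter (· ≠ x), K) / (Q : ℝ) ^ (M + M),
    fun ρ hρ => ?_⟩
  rw [frameErrorRate, div_mul_eq_mul_div, Finset.sum_mul]
  simp only [Finset.sum_mul]
  refine div_le_div_of_nonneg_right (Finset.sum_le_sum fun x _ => ?_) (by positivity)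
  have hsub : {ω : (Fin N → Fin M → ℂ) × (Fin N → ℂ) | ¬ decides (realChannel ρ ω.1)
      (received (realChannel ρ ω.1) (realNoise ω.2) x) x} ⊆
      ⋃ x' ∈ Finset.univ.filter (· ≠ x), {ω | IsClose (realChannel ρ ω.1 * generator Q (M + M))
        (realNoise ω.2) B (toReal x - toReal x')} := by
    intro ω hω
    obtain ⟨x', hne, hx'⟩ := h _ _ _ hω
    exact Set.mem_biUnion (by simpa using hne) hx'
  refine (measureReal_mono hsub (measure_ne_top _ _)).trans ((measureReal_biUnion_finset_le _ _).trans ?_)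
  refine Finset.sum_le_sum fun x' hx' => ?_
  obtain ⟨k, hk⟩ := exists_one_le_abs_sub (Finset.mem_filter.1 hx').2
  exact channelLaw_isClose_le hQ hM hρ B hk

end UpperBound

/-! ### The lower bound: two indistinguishable transmissions -/

section LowerBound

variable {N M Q : ℕ}

/-- The event that the gains from the transmit antenna `j` have length at most `r` and the noise
has length at most `1`, for every receive antenna. -/
def weakEvent (N : ℕ) {M : ℕ} (j : Fin M) (r : ℝ) : Set ((Fin N → Fin M → ℂ) × (Fin N → ℂ)) :=
  {h | ∀ i, ‖h i j‖ ≤ r} ×ˢ (Set.univ.pi fun _ => Metric.closedBall 0 1)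

lemma measurableSet_weakEvent (j : Fin M) (r : ℝ) : MeasurableSet (weakEvent N j r) := by
  refine MeasurableSet.prod ?_ (MeasurableSet.univ_pi fun _ => measurableSet_closedBall)
  rw [Set.ofPred_forall]
  exact MeasurableSet.iInter fun i => measurableSet_le (by fun_prop) measurable_const

lemma exists_le_channelLaw_weakEvent (N : ℕ) {M : ℕ} (j : Fin M) : ∃ c : ℝ, 0 < c ∧
    ∀ r : ℝ, 0 ≤ r → r ≤ 1 → c * (r ^ 2) ^ N ≤ (channelLaw N M).real (weakEvent N j r) := by
  obtain ⟨c, hc, h⟩ := exists_le_complexGaussian_closedBall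
  refine ⟨c ^ N * c ^ N, by positivity, fun r hr hr1 => ?_⟩
  have hset : {h : Fin N → Fin M → ℂ | ∀ i, ‖h i j‖ ≤ r} = Set.univ.pi fun _ =>
      Set.univ.pi fun j' => if j' = j then Metric.closedBall 0 r else Set.univ := by
    ext h
    simp only [Set.mem_ofPred_eq, Set.mem_univ_pi]
    refine forall_congr' fun i => ⟨fun hi j' => ?_, fun hi => ?_⟩
    · split_ifs with hj
      · subst hj; simpa using hi
      · trivial
    · simpa using hi j
  have hrow : ∏ j' : Fin M, complexGaussian (if j' = j then Metric.closedBall 0 r else Set.univ)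
      = complexGaussian (Metric.closedBall 0 r) := by
    rw [Finset.prod_eq_single j]
    · simp
    · intro j' _ hj'
      simp [hj']
    · simp
  have hmeas : (channelLaw N M).real (weakEvent N j r)
      = complexGaussian.real (Metric.closedBall 0 r) ^ N *
        complexGaussian.real (Metric.closedBall 0 1) ^ N := by
    rw [channelLaw, weakEvent, hset, Measure.real, Measure.prod_prod, Measure.pi_pi, Measure.pi_pi]
    simp only [Measure.pi_pi, hrow, Finset.prod_const, Finset.card_univ, Fintype.card_fin,
      ENNReal.toReal_mul, ENNReal.toReal_pow, Measure.real]
  rw [hmeas]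
  have h1 := h r hr hr1
  have h2 := h 1 zero_le_one le_rfl
  calc c ^ N * c ^ N * (r ^ 2) ^ N = (c * r ^ 2) ^ N * (c * 1 ^ 2) ^ N := by
        rw [mul_pow c, one_pow, mul_one]; ring
    _ ≤ _ := by gcongr

/-- On a weak event the signal of antenna `j` shifts the noise by a bounded amount only, which
changes probabilities at most by a constant factor. -/
lemma exists_channelLaw_shift_le (N : ℕ) {M : ℕ} (j : Fin M) : ∃ C : ℝ, 0 ≤ C ∧ ∀ g : ℝ, 0 < g →
    ∀ E : Set ((Fin N → Fin M → ℂ) × (Fin N → ℂ)),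
      (channelLaw N M).real
          (weakEvent N j g⁻¹ ∩ (fun ω => (ω.1, ω.2 + fun i => (g : ℂ) * ω.1 i j)) ⁻¹' E)
        ≤ C * (channelLaw N M).real E := by
  obtain ⟨C, hC, hshift⟩ := exists_map_add_complexGaussian_le
  refine ⟨(C ^ N).toReal, ENNReal.toReal_nonneg, fun g hg E => ?_⟩
  suffices hle : channelLaw N M
      (weakEvent N j g⁻¹ ∩ (fun ω => (ω.1, ω.2 + fun i => (g : ℂ) * ω.1 i j)) ⁻¹' E)
      ≤ C ^ N * channelLaw N M E by
    rw [Measure.real, Measure.real, ← ENNReal.toReal_mul]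
    exact ENNReal.toReal_mono
      (ENNReal.mul_ne_top (ENNReal.pow_ne_top hC) (measure_ne_top _ _)) hle
  -- the event `E` need not be measurable, but it has a measurable hull of the same measure
  set E' := toMeasurable (channelLaw N M) E with hE'
  have hEm : MeasurableSet E' := measurableSet_toMeasurable _ _
  rw [← measure_toMeasurable E]
  refine (measure_mono (Set.inter_subset_inter_right _
    (Set.preimage_mono (subset_toMeasurable (channelLaw N M) E)))).trans ?_
  rw [← hE']
  have hT : Measurable fun ω : (Fin N → Fin M → ℂ) × (Fin N → ℂ) =>
      (ω.1, ω.2 + fun i => (g : ℂ) * ω.1 i j) := by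
    refine measurable_fst.prodMk (measurable_snd.add ?_)
    exact measurable_pi_lambda _ fun i => by fun_prop
  have hS := (measurableSet_weakEvent (N := N) j g⁻¹).inter (hT hEm)
  rw [channelLaw, Measure.prod_apply hS, Measure.prod_apply hEm,
    ← lintegral_const_mul _ (measurable_measure_prodMk_left hEm)]
  refine lintegral_mono fun h => ?_
  by_cases hh : ∀ i, ‖h i j‖ ≤ g⁻¹
  swap
  · have hempty : Prod.mk h ⁻¹' (weakEvent N j g⁻¹ ∩
        (fun ω => (ω.1, ω.2 + fun i => (g : ℂ) * ω.1 i j)) ⁻¹' E') = ∅ := by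
      ext z
      simp [weakEvent, hh]
    simp only [hempty, measure_empty, zero_le]
  set a : Fin N → ℂ := fun i => (g : ℂ) * h i j with ha
  have ha1 : ∀ i, ‖a i‖ ≤ 1 := by
    intro i
    rw [ha]
    simp only [norm_mul, Complex.norm_real, Real.norm_eq_abs, abs_of_pos hg]
    calc g * ‖h i j‖ ≤ g * g⁻¹ := mul_le_mul_of_nonneg_left (hh i) hg.le
      _ = 1 := mul_inv_cancel₀ hg.ne'
  have hslice : MeasurableSet (Prod.mk h ⁻¹' E') := measurable_prodMk_left hEm
  have hadd : Measurable fun (z : Fin N → ℂ) i => z i + a i :=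
    measurable_pi_lambda _ fun i => by fun_prop
  calc (Measure.pi fun _ => complexGaussian) (Prod.mk h ⁻¹' (weakEvent N j g⁻¹ ∩
        (fun ω => (ω.1, ω.2 + fun i => (g : ℂ) * ω.1 i j)) ⁻¹' E'))
      = (((Measure.pi fun _ : Fin N => complexGaussian).restrict
          (Set.univ.pi fun _ => Metric.closedBall 0 1)).map (fun z i => z i + a i))
          (Prod.mk h ⁻¹' E') := by
        rw [Measure.map_apply hadd hslice, Measure.restrict_apply (hadd hslice)]
        congr 1
        ext z
        simp only [weakEvent, Set.mem_preimage, Set.mem_inter_iff, Set.mem_prod,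
          Set.mem_ofPred_eq, hh, implies_true, true_and]
        exact and_comm
    _ = (Measure.pi fun i => (complexGaussian.restrict (Metric.closedBall 0 1)).map
          (fun z => z + a i)) (Prod.mk h ⁻¹' E') := by
        rw [Measure.restrict_pi_pi, Measure.pi_map_pi (f := fun i z => z + a i)
          (fun i => by fun_prop)]
    _ ≤ (Measure.pi fun _ : Fin N => C • complexGaussian) (Prod.mk h ⁻¹' E') :=
        measure_pi_mono (fun i => hshift (a i) (ha1 i)) _
    _ = C ^ N * (Measure.pi fun _ : Fin N => complexGaussian) (Prod.mk h ⁻¹' E') := by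
        rw [measure_pi_smul _ hC, Fintype.card_fin, Measure.smul_apply, smul_eq_mul]

theorem le_frameErrorRate (hQ : 2 ≤ Q) (hM : 1 ≤ M)
    {decides : Matrix (Fin N ⊕ Fin N) (Fin (M + M)) ℝ → (Fin N ⊕ Fin N → ℝ) →
      (Fin (M + M) → Fin Q) → Prop} (hfun : IsFunctional decides) :
    ∃ c : ℝ, 0 < c ∧ ∀ᶠ ρ : ℝ in atTop, c * (ρ ^ N)⁻¹ ≤ frameErrorRate decides ρ := by
  have hk := kappa_pos hQ
  have hM0 : (0 : ℝ) < M := by exact_mod_cast hM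
  have hQ0 : (0 : ℝ) < Q := by exact_mod_cast (by omega : 0 < Q)
  let j : Fin M := ⟨0, hM⟩
  obtain ⟨c, hc, hweak⟩ := exists_le_channelLaw_weakEvent N j
  obtain ⟨C, hC, hshift⟩ := exists_channelLaw_shift_le N j
  -- two vectors that differ by `1` in the real part of the first symbol
  let x' : Fin (M + M) → Fin Q := fun _ => ⟨0, by omega⟩
  let x : Fin (M + M) → Fin Q := Function.update x' (Fin.castAdd M j) ⟨1, by omega⟩
  have hx : toReal x - toReal x' = Pi.single (Fin.castAdd M j) 1 := by
    funext k
    by_cases hk : k = Fin.castAdd M j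
    · subst hk; simp [toReal, x, x']
    · simp [toReal, x, x', hk]
  have hxx : x ≠ x' := by
    intro h
    have := congrFun hx (Fin.castAdd M j)
    simp [h] at this
  have hsig : ∀ (ρ : ℝ) (h : Fin N → Fin M → ℂ),
      complexSignal Q ρ h (toReal x - toReal x') = fun i => (gain Q M ρ : ℂ) * h i j := by
    intro ρ h
    have h1 : toComplex (toReal x - toReal x') = Pi.single j 1 := by
      rw [hx]
      funext k
      have hne : Fin.natAdd M k ≠ Fin.castAdd M j := by
        intro h0
        have := congrArg Fin.val h0
        simp only [Fin.val_natAdd, Fin.val_castAdd] at this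
        have := j.2
        omega
      by_cases hk : k = j
      · subst hk
        apply Complex.ext <;> simp [toComplex, -Fin.natAdd_eq_addNat, hne]
      · have hne' : Fin.castAdd M k ≠ Fin.castAdd M j :=
          fun h0 => hk (Fin.castAdd_injective M M h0)
        apply Complex.ext <;> simp [toComplex, -Fin.natAdd_eq_addNat, hne, hne', hk]
    funext i
    simp only [complexSignal]
    rw [h1]
    congr 1
    rw [Finset.sum_eq_single j]
    · simp
    · intro k _ hk
      simp [hk]
    · simp
  refine ⟨c * (M / kappa Q ^ 2) ^ N / (1 + C) / (Q : ℝ) ^ (M + M), by positivity, ?_⟩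
  filter_upwards [eventually_gt_atTop 0, eventually_ge_atTop (M / kappa Q ^ 2)] with ρ hρ hρ1
  set g := gain Q M ρ with hg
  have hg0 : 0 < g := gain_pos hQ hM hρ
  have hg2 : (g⁻¹) ^ 2 = M / kappa Q ^ 2 * ρ⁻¹ := by
    rw [inv_pow, hg, gain_sq hρ.le]
    field_simp
  have hg1 : g⁻¹ ≤ 1 := by
    have : (g⁻¹) ^ 2 ≤ 1 := by
      rw [hg2, ← div_eq_mul_inv, div_le_one hρ]
      exact hρ1
    exact (sq_le_one_iff₀ (inv_nonneg.2 hg0.le)).1 this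
  let err : (Fin (M + M) → Fin Q) → Set ((Fin N → Fin M → ℂ) × (Fin N → ℂ)) := fun x =>
    {ω | ¬ decides (realChannel ρ ω.1) (received (realChannel ρ ω.1) (realNoise ω.2) x) x}
  have hcover : weakEvent N j g⁻¹ ⊆ err x ∪ (weakEvent N j g⁻¹ ∩
      (fun ω => (ω.1, ω.2 + fun i => (g : ℂ) * ω.1 i j)) ⁻¹' err x') := by
    intro ω hω
    by_cases herr : ω ∈ err x
    · exact Or.inl herr
    · refine Or.inr ⟨hω, fun hdec => hxx ?_⟩
      simp only [err, Set.mem_ofPred_eq, not_not] at herr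
      simp only [hg, ← hsig ρ ω.1, received_add_complexSignal] at hdec
      exact hfun _ _ _ _ herr hdec
  have hbound : c * ((g⁻¹) ^ 2) ^ N ≤
      (channelLaw N M).real (err x) + C * (channelLaw N M).real (err x') :=
    (hweak g⁻¹ (inv_nonneg.2 hg0.le) hg1).trans <| (measureReal_mono hcover).trans <|
      (measureReal_union_le _ _).trans <| add_le_add_right (hshift g hg0 _) _
  have hsum : ∀ x₀, (channelLaw N M).real (err x₀) ≤ ∑ x, (channelLaw N M).real (err x) :=
    fun x₀ => Finset.single_le_sum (f := fun x => (channelLaw N M).real (err x))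
      (fun _ _ => measureReal_nonneg) (Finset.mem_univ x₀)
  have htotal : c * ((g⁻¹) ^ 2) ^ N ≤ (1 + C) * ∑ x, (channelLaw N M).real (err x) := by
    have h1 := mul_le_mul_of_nonneg_left (hsum x') hC
    linarith [hsum x]
  rw [frameErrorRate]
  change _ ≤ (∑ x, (channelLaw N M).real (err x)) / _
  rw [div_mul_eq_mul_div]
  refine div_le_div_of_nonneg_right ?_ (by positivity)
  rw [div_mul_eq_mul_div, div_le_iff₀ (by positivity)]
  rw [hg2, mul_pow, inv_pow] at htotal
  linarith

end LowerBound

/-! ### The order of the frame error rate -/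

lemma hasDiversityOrder_of_isTheta {P : ℝ → ℝ} {d : ℝ}
    (h : P =Θ[atTop] fun ρ : ℝ => ρ ^ (-d)) : HasDiversityOrder P d := by
  obtain ⟨C, hC, hup⟩ := h.1.exists_pos
  obtain ⟨c, hc, hlow⟩ := h.2.exists_pos
  have hlim : ∀ a : ℝ, Tendsto (fun ρ : ℝ => d - Real.log a / Real.log ρ) atTop (𝓝 d) := by
    intro a
    simpa using tendsto_const_nhds.sub (Real.tendsto_log_atTop.const_div_atTop (Real.log a))
  refine tendsto_of_tendsto_of_tendsto_of_le_of_le' (hlim C) (hlim c⁻¹) ?_ ?_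
  · -- `Real.log` is even, so the sign of `P` does not matter
    filter_upwards [hup.bound, hlow.bound, eventually_gt_atTop 1] with ρ h1 h2 hρ
    have hρ0 : 0 < ρ := by linarith
    have hpow : 0 < ρ ^ (-d) := Real.rpow_pos_of_pos hρ0 _
    have hlog : 0 < Real.log ρ := Real.log_pos hρ
    rw [Real.norm_eq_abs, Real.norm_eq_abs, abs_of_pos hpow] at h1 h2
    have hP : 0 < |P ρ| := by
      by_contra h0
      have := mul_nonpos_of_nonneg_of_nonpos hc.le (not_lt.1 h0)
      linarith
    have := Real.log_le_log hP h1
    rw [Real.log_abs, Real.log_mul hC.ne' hpow.ne', Real.log_rpow hρ0] at this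
    rw [le_div_iff₀ hlog, sub_mul, div_mul_cancel₀ _ hlog.ne']
    linarith
  · filter_upwards [hlow.bound, eventually_gt_atTop 1] with ρ h2 hρ
    have hρ0 : 0 < ρ := by linarith
    have hpow : 0 < ρ ^ (-d) := Real.rpow_pos_of_pos hρ0 _
    have hlog : 0 < Real.log ρ := Real.log_pos hρ
    rw [Real.norm_eq_abs, Real.norm_eq_abs, abs_of_pos hpow] at h2
    have hP : 0 < |P ρ| := by
      by_contra h0
      have := mul_nonpos_of_nonneg_of_nonpos hc.le (not_lt.1 h0)
      linarith
    have := Real.log_le_log hpow h2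
    rw [Real.log_mul hc.ne' hP.ne', Real.log_abs, Real.log_rpow hρ0] at this
    rw [div_le_iff₀ hlog, sub_mul, div_mul_cancel₀ _ hlog.ne', Real.log_inv]
    linarith

/-- A deterministic decoder all of whose errors are close has a frame error rate of exact
order `ρ ^ (-N)`. -/
theorem frameErrorRate_isTheta {N M Q : ℕ} (hQ : 2 ≤ Q) (hM : 1 ≤ M) {B : ℝ}
    {decides : Matrix (Fin N ⊕ Fin N) (Fin (M + M)) ℝ → (Fin N ⊕ Fin N → ℝ) →
      (Fin (M + M) → Fin Q) → Prop} (h : ErrsClosely B decides) (hfun : IsFunctional decides) :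
    frameErrorRate decides =Θ[atTop] fun ρ : ℝ => ρ ^ (-(((2 * N : ℕ) : ℝ) / 2)) := by
  have hpow : ∀ ρ : ℝ, 0 < ρ → ρ ^ (-(((2 * N : ℕ) : ℝ) / 2)) = (ρ ^ N)⁻¹ := by
    intro ρ hρ
    rw [Real.rpow_neg hρ.le, ← Real.rpow_natCast]
    congr 2
    push_cast
    ring
  have hnn : ∀ ρ, 0 ≤ frameErrorRate decides ρ := fun ρ =>
    div_nonneg (Finset.sum_nonneg fun _ _ => measureReal_nonneg) (by positivity)
  obtain ⟨C, hup⟩ := frameErrorRate_le hQ hM h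
  obtain ⟨c, hc, hlow⟩ := le_frameErrorRate hQ hM hfun
  constructor
  · refine IsBigO.of_bound C ?_
    filter_upwards [eventually_gt_atTop 0] with ρ hρ
    rw [hpow ρ hρ, Real.norm_of_nonneg (hnn ρ), Real.norm_of_nonneg (by positivity)]
    exact hup ρ hρ
  · refine IsBigO.of_bound c⁻¹ ?_
    filter_upwards [eventually_gt_atTop 0, hlow] with ρ hρ hl
    rw [hpow ρ hρ, Real.norm_of_nonneg (hnn ρ), Real.norm_of_nonneg (by positivity),
      le_inv_mul_iff₀ hc]
    exact hl

end VBlast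

end

theorem theorem3 (N M Q : ℕ) (hM : 1 ≤ M) (hMN : M ≤ N) (hQ : 2 ≤ Q)
    (b Δ : ℝ) (hb : 0 ≤ b) (hΔ : 0 < Δ)
    (qr : Matrix (Fin N ⊕ Fin N) (Fin (M + M)) ℝ →
      Matrix (Fin N ⊕ Fin N) (Fin (M + M)) ℝ × Matrix (Fin (M + M)) (Fin (M + M)) ℝ)
    (hqr : ∀ A, VBlast.IsQR A (qr A).1 (qr A).2)
    (ml : Matrix (Fin N ⊕ Fin N) (Fin (M + M)) ℝ → (Fin N ⊕ Fin N → ℝ) →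
      (Fin (M + M) → Fin Q))
    (hml : VBlast.IsMLDecoder ml) :
    -- the maximum likelihood decoder, the stack algorithm and the Fano decoder
    -- have the same diversity order `n / 2`, where `n = 2 N`
    (VBlast.HasDiversityOrder (VBlast.frameErrorRate (VBlast.mlDecides ml))
        (((2 * N : ℕ) : ℝ) / 2) ∧
      VBlast.HasDiversityOrder
        (VBlast.frameErrorRate (Q := Q) (VBlast.stackDecides qr b)) (((2 * N : ℕ) : ℝ) / 2) ∧
      VBlast.HasDiversityOrder
        (VBlast.frameErrorRate (Q := Q) (VBlast.fanoDecides qr b Δ)) (((2 * N : ℕ) : ℝ) / 2)) ∧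
    -- and all three frame error rates are of the exact order `ρ ^ (-n / 2)`
    ((VBlast.frameErrorRate (VBlast.mlDecides ml)
        =Θ[atTop] fun ρ : ℝ => ρ ^ (-(((2 * N : ℕ) : ℝ) / 2))) ∧
      (VBlast.frameErrorRate (Q := Q) (VBlast.stackDecides qr b)
        =Θ[atTop] fun ρ : ℝ => ρ ^ (-(((2 * N : ℕ) : ℝ) / 2))) ∧
      (VBlast.frameErrorRate (Q := Q) (VBlast.fanoDecides qr b Δ)
        =Θ[atTop] fun ρ : ℝ => ρ ^ (-(((2 * N : ℕ) : ℝ) / 2)))) := by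
  have hml' := VBlast.frameErrorRate_isTheta hQ hM (VBlast.mlDecides_errsClosely hml)
    (VBlast.mlDecides_isFunctional ml)
  have hstack := VBlast.frameErrorRate_isTheta hQ hM
    (VBlast.stackDecides_errsClosely (Q := Q) hqr hb) VBlast.stackDecides_isFunctional
  have hfano := VBlast.frameErrorRate_isTheta hQ hM
    (VBlast.fanoDecides_errsClosely (Q := Q) hqr (by omega) hb hΔ) VBlast.fanoDecides_isFunctional
  exact ⟨⟨VBlast.hasDiversityOrder_of_isTheta hml', VBlast.hasDiversityOrder_of_isTheta hstack,
    VBlast.hasDiversityOrder_of_isTheta hfano⟩, hml', hstack, hfano⟩
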